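/- Let $\Omega\subset\mathbb{R}^d$ be a bounded domain and let $(V,\|\cdot\|)$ be a real Hilbert space. Let $\mu$ be a (jointly measurable) Gaussian random field over $\Omega$ with trajectories in $L^2(\Omega)$, with mean $m\in L^2(\Omega)$ and covariance kernel $\mathrm{Cov}\in L^2(\Omega\times\Omega)$, and let $\mathbb{P}$ be its law. For a map $F:W\to Y$ between normed spaces, let its local variation be $$\|\partial F\|(w):=\limsup_{h\to0}\frac{\|F(w+h)-F(w)\|_{Y}}{\|h\|_{W}}\in[0,+\infty].$$ Let $\mathcal{G}:L^2(\Omega)\to V$ satisfy, for some constants $A,\beta>0$, $$\|\partial\mathcal{G}\|(\nu)\le A e^{\beta\|\nu\|_{L^2(\Omega)}}\quad\text{for all }\nu\in L^2(\Omega),$$ and put $u=u_\mu:=\mathcal{G}(\mu)$. Then $\mu-m$ and $u$ admit Kosambi-Karhunen-Loève (KKL) expansions $$\mu=m+\sum_{i\ge1}\sqrt{\lambda_i^\mu}\,\eta_i\varphi_i,\qquad u=\sum_{i\ge1}\sqrt{\lambda_i^u}\,\omega_i v_i\qquad\text{almost surely},$$ where $\lambda_1^\mu\ge\lambda_2^\mu\ge\dots\ge0$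 and $\lambda_1^u\ge\lambda_2^u\ge\dots\ge0$ are summable, $(\varphi_i)$ and $(v_i)$ are orthonormal in $L^2(\Omega)$ and in $V$, and $\mathbb{E}[\eta_i\eta_j]=\mathbb{E}[\omega_i\omega_j]=\delta_{ij}$ (these conditions concerning only the indices with nonzero eigenvalue). For any such expansions let $$B:=\mathcal{G}\Big(\Big\{m+\sum_{i\ge1}\sqrt{\lambda_i^\mu}\,\nu_i\varphi_i\;:\;\sum_{i\ge1}|\nu_i|^2\le1\Big\}\Big).$$ For $M,L>0$, let $\mathcal{E}_{B,M}(V,\mathbb{R}^n)$ be the set of all measurable $\Psi':V\to\mathbb{R}^n$ with $\mathbb{E}|\Psi'(u)|<\infty$ and $\sup_{v\in B}|\Psi'(v)|\le M$, and let $\mathcal{D}_{M,L}(\mathbb{R}^n,V)$ be the set of all measurable $\Psi:\mathbb{R}^n\to V$ with $\sup_{c\in[-M,M]^n}\|\partial\Psi\|(c)\le L$. Then there exist a constant $C=C(d,\mathcal{G},\mathbb{P})>0$ and constants $L_0=L_0(n,\mathcal{G},\mathbb{P})>0$ such that, for all latent dimensions $n\ge1$, all $M\ge1$ and all $L\ge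 L_0$, $$\inf_{\substack{\Psi'\in\mathcal{E}_{B,M}(V,\mathbb{R}^n)\\ \Psi\in\mathcal{D}_{M,L}(\mathbb{R}^n,V)}}\mathbb{E}\,\|u-\Psi(\Psi'(u))\|\;\le\;C\min\Big\{\sqrt{\textstyle\sum_{i>n}\lambda_i^\mu},\;\sqrt{\textstyle\sum_{i>n}\lambda_i^u}\Big\}.$$ -/

import Mathlib

open MeasureTheory ProbabilityTheory Filter Topology
open scoped ENNReal

noncomputable section

/-- The Lebesgue measure on (the subtype of) a subset `Ω` of `ℝᵈ`. -/
abbrev lebesgueOn {d : ℕ} (Ω : Set (EuclideanSpace ℝ (Fin d))) : Measure Ω :=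
  Measure.comap Subtype.val volume

/-- The real Hilbert space `L²(Ω)`. -/
abbrev L2 {d : ℕ} (Ω : Set (EuclideanSpace ℝ (Fin d))) : Type :=
  Lp ℝ 2 (lebesgueOn Ω)

/-- The local variation `‖∂G‖(w) = limsup_{h → 0, h ≠ 0} ‖G (w + h) - G w‖ / ‖h‖ ∈ [0, ∞]` of a map
between normed spaces. -/
def localVariation {W V : Type*} [NormedAddCommGroup W] [NormedAddCommGroup V]
    (G : W → V) (w : W) : ℝ≥0∞ :=
  limsup (fun h : W => ‖G (w + h) - G w‖ₑ / ‖h‖ₑ) (𝓝[≠] 0)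

/-- `U = ∑ᵢ √λᵢ ωᵢ eᵢ` almost surely is a Kosambi-Karhunen-Loève expansion of the random element `U`
of a Hilbert space: `λ₀ ≥ λ₁ ≥ … ≥ 0` is summable, the `eᵢ` are orthonormal, and the scalar random
variables `ωᵢ` satisfy `𝔼[ωᵢ ωⱼ] = δᵢⱼ`. Where `λᵢ = 0` the `i`-th term vanishes, and nothing is
required of `ωᵢ` and `eᵢ`; so finite-dimensional (and non-separable) spaces and degenerate random
elements are covered, and completing the `eᵢ` to an orthonormal basis changes nothing. -/
structure IsKKLExpansion {S H : Type*} [MeasurableSpace S] [NormedAddCommGroup H]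
    [InnerProductSpace ℝ H] (P : Measure S) (U : S → H) (lam : ℕ → ℝ) (ω : ℕ → S → ℝ)
    (e : ℕ → H) : Prop where
  nonneg : ∀ i, 0 ≤ lam i
  antitone : Antitone lam
  summable : Summable lam
  orthonormal : Orthonormal ℝ (fun i : {i : ℕ // lam i ≠ 0} => e i)
  memLp : ∀ i, lam i ≠ 0 → MemLp (ω i) 2 P
  uncorrelated : ∀ i j, lam i ≠ 0 → lam j ≠ 0 →
    ∫ s, ω i s * ω j s ∂P = if i = j then 1 else 0
  expansion : ∀ᵐ s ∂P, HasSum (fun i => (√(lam i) * ω i s) • e i) (U s)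

/-- The set `{m + ∑ᵢ √λᵢ νᵢ φᵢ : ∑ᵢ νᵢ² ≤ 1}`. -/
def kklEllipsoid {H : Type*} [NormedAddCommGroup H] [InnerProductSpace ℝ H]
    (m : H) (lam : ℕ → ℝ) (φ : ℕ → H) : Set H :=
  {w | ∃ ν : ℕ → ℝ, Summable (fun i => ν i ^ 2) ∧ ∑' i, ν i ^ 2 ≤ 1 ∧
    HasSum (fun i => (√(lam i) * ν i) • φ i) (w - m)}

section Autoencoders

variable {S V : Type*} [MeasurableSpace S] [NormedAddCommGroup V] [MeasurableSpace V]

/-- Admissible encoders `V → ℝⁿ` for the random element `u`: measurable maps with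
`𝔼|Ψ'(u)| < ∞` that are bounded by `M` on the control set `B`. -/
def admissibleEncoders (P : Measure S) (u : S → V) (B : Set V) (M : ℝ) (n : ℕ) :
    Set (V → EuclideanSpace ℝ (Fin n)) :=
  {Ψ' | Measurable Ψ' ∧ ∫⁻ s, ‖Ψ' (u s)‖ₑ ∂P < ∞ ∧ ∀ v ∈ B, ‖Ψ' v‖ ≤ M}

/-- Admissible decoders `ℝⁿ → V`: measurable maps whose local variation is at most `L` on the
hypercube `[-M, M]ⁿ`. -/
def admissibleDecoders (V : Type*) [NormedAddCommGroup V] [MeasurableSpace V] (M L : ℝ) (n : ℕ) :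
    Set (EuclideanSpace ℝ (Fin n) → V) :=
  {Ψ | Measurable Ψ ∧ ∀ c : EuclideanSpace ℝ (Fin n), (∀ i, |c i| ≤ M) →
    localVariation Ψ c ≤ ENNReal.ofReal L}

/-- The optimal reconstruction error `inf 𝔼‖u - Ψ(Ψ'(u))‖ ∈ [0, ∞]` over all admissible
encoder-decoder pairs with latent dimension `n`. -/
def optimalError (P : Measure S) (u : S → V) (B : Set V) (M L : ℝ) (n : ℕ) : ℝ≥0∞ :=
  ⨅ Ψ' ∈ admissibleEncoders P u B M n, ⨅ Ψ ∈ admissibleDecoders V M L n,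
    ∫⁻ s, ‖u s - Ψ (Ψ' (u s))‖ₑ ∂P

end Autoencoders

end

/-! The two terms of the minimum are bounded separately, with constants fixed before any expansion
is chosen.

Output spectrum: principal component analysis of `u` has root mean square error equal to the root of
the eigenvalue tail. Dividing the codes by a bound `R` for the norm on the control set makes them at
most `1` there, and the decoder is then `R`-Lipschitz (`IsKKLExpansion.optimalError_le`).

Input spectrum: the decoder parametrizes `G` on `m` plus the span of the leading input modes. Its
Lipschitz constants grow exponentially with the code, but a radial change of variables stretches the
code space just as fast, so the decoder becomes globally Lipschitz
(`exists_lipschitz_reparametrization`). The encoder sees only `u = G(μ)`, which need not determine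
`μ`. It therefore nearly minimizes the reconstruction error, and so does almost as well as the code
of the leading coefficients of `μ`. Near the control set its codes are confined to the unit ball, at
an error of order `√λₙ`; elsewhere a small penalty keeps them integrable
(`optimalError_le_of_lipschitz_decoder`). The mean value inequality bounds the remaining error by an
exponential of `‖μ‖` times the truncation error of `μ - m`; Cauchy-Schwarz and Fernique's theorem
turn this into the root of the tail.

Fernique's theorem needs a Gaussian law on `L²`, that is, Gaussian integrals of the field against
test functions; these come from the law of large numbers
(`IsGaussianProcess.hasGaussianLaw_integral`). The expansions themselves come from diagonalizing the
second moment operator. -/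

/-! ### Spectral theorem for compact positive operators, by deflation -/

section CompactPositive

open InnerProductSpace Module.End

variable {H : Type*} [NormedAddCommGroup H] [InnerProductSpace ℝ H] [CompleteSpace H]

/-- A compact positive operator attains its norm at an eigenvector. -/
theorem exists_top_eigenvector {T : H →L[ℝ] H} (hT : IsCompactOperator T) (hp : T.IsPositive) :
    ∃ e : H, T e = ‖T‖ • e ∧ (T ≠ 0 ∧ ‖e‖ = 1 ∨ T = 0 ∧ e = 0) := by
  by_cases h0 : T = 0
  · exact ⟨0, by simp [h0]⟩
  -- Self-adjointness puts a point of modulus `‖T‖` in the spectrum, compactness makes it an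
  -- eigenvalue, and positivity fixes its sign.
  have hrad : spectralRadius ℝ T = ‖T‖₊ := T.spectralRadius_eq_nnnorm hp.isSelfAdjoint
  have hne : (spectrum ℝ T).Nonempty := by
    by_contra hne
    rw [Set.not_nonempty_iff_eq_empty] at hne
    rw [spectralRadius, hne] at hrad
    simp only [Set.mem_empty_iff_false, iSup_false, bot_eq_zero] at hrad
    rw [ciSup_const] at hrad
    exact h0 (by simpa using hrad.symm)
  obtain ⟨k, hk, hkn⟩ := spectrum.exists_nnnorm_eq_spectralRadius_of_nonempty hne
  have hkn' : ‖k‖ = ‖T‖ := by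
    rw [hrad] at hkn
    exact congrArg NNReal.toReal (by exact_mod_cast hkn)
  have hk0 : k ≠ 0 := by
    rintro rfl
    exact h0 (by simpa using hkn'.symm)
  have hev : HasEigenvalue (T : Module.End ℝ H) k := (hT.hasEigenvalue_iff_mem_spectrum hk0).2 hk
  obtain ⟨v, hv⟩ := hev.exists_hasEigenvector
  have hTv : T v = k • v := hv.apply_eq_smul
  have hv0 : 0 < ‖v‖ := norm_pos_iff.2 hv.2
  have hkpos : 0 ≤ k := by
    have := hp.inner_nonneg_left v
    rw [hTv, inner_smul_left, real_inner_self_eq_norm_sq] at this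
    exact nonneg_of_mul_nonneg_left this (by positivity)
  have hkT : k = ‖T‖ := by rw [← hkn', Real.norm_of_nonneg hkpos]
  refine ⟨‖v‖⁻¹ • v, ?_, Or.inl ⟨h0, ?_⟩⟩
  · rw [map_smul, hTv, ← hkT, smul_comm]
  · rw [norm_smul, norm_inv, norm_norm, inv_mul_cancel₀ hv0.ne']

/-- Compact positive operators. -/
abbrev CompactPositive (H : Type*) [NormedAddCommGroup H] [InnerProductSpace ℝ H] : Type _ :=
  {T : H →L[ℝ] H // IsCompactOperator T ∧ T.IsPositive}

namespace CompactPositive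

/-- A unit eigenvector of `T` for the eigenvalue `‖T‖`, or `0` if `T = 0`. -/
noncomputable def top (T : CompactPositive H) : H :=
  (exists_top_eigenvector T.2.1 T.2.2).choose

theorem apply_top (T : CompactPositive H) : T.1 T.top = ‖T.1‖ • T.top :=
  (exists_top_eigenvector T.2.1 T.2.2).choose_spec.1

theorem norm_top (T : CompactPositive H) : T.1 ≠ 0 ∧ ‖T.top‖ = 1 ∨ T.1 = 0 ∧ T.top = 0 :=
  (exists_top_eigenvector T.2.1 T.2.2).choose_spec.2

theorem norm_top_of_ne_zero (T : CompactPositive H) (h : ‖T.1‖ ≠ 0) : ‖T.top‖ = 1 :=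
  (T.norm_top.resolve_right fun h' => h (by simp [h'.1])).2

theorem inner_top (T : CompactPositive H) (x : H) :
    inner ℝ (T.1 x) T.top = ‖T.1‖ * inner ℝ x T.top := by
  rw [T.2.2.inner_left_eq_inner_right, apply_top, inner_smul_right]

theorem norm_mul_norm_top_sq (T : CompactPositive H) : ‖T.1‖ * ‖T.top‖ ^ 2 = ‖T.1‖ := by
  rcases T.norm_top with ⟨-, h⟩ | h <;> simp [h]

/-- The operator with its top eigenpair removed, as a composition. -/
theorem sub_rankOne_apply (T : CompactPositive H) (x : H) :
    (T.1 - ‖T.1‖ • rankOne ℝ T.top T.top) x = T.1 (x - inner ℝ T.top x • T.top) := by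
  simp [apply_top, smul_smul, mul_comm]

/-- The deflated operator maps into the complement of `T.top`, so its quadratic form at `x` is that
of `T` at `x - ⟪T.top, x⟫ • T.top`. -/
theorem isPositive_sub_rankOne (T : CompactPositive H) :
    (T.1 - ‖T.1‖ • rankOne ℝ T.top T.top).IsPositive := by
  rw [ContinuousLinearMap.isPositive_iff]
  constructor
  · have h1 := T.2.2.isSymmetric
    intro x y
    have := h1 x y
    simp only [ContinuousLinearMap.coe_coe] at this
    simp [inner_sub_left, inner_sub_right, inner_smul_left, inner_smul_right, this,
      real_inner_comm]
    left; ring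
  · intro x
    have h := T.2.2.inner_nonneg_left (x - inner ℝ T.top x • T.top)
    rw [← sub_rankOne_apply, inner_sub_right, inner_smul_right] at h
    rwa [show inner ℝ ((T.1 - ‖T.1‖ • rankOne ℝ T.top T.top) x) T.top = 0 by
      simp only [_root_.sub_apply, _root_.smul_apply, rankOne_apply,
        inner_sub_left, inner_smul_left, inner_top, real_inner_self_eq_norm_sq, conj_trivial]
      have := T.norm_mul_norm_top_sq
      rw [real_inner_comm x]
      linear_combination (- inner ℝ x T.top) * this, mul_zero, sub_zero] at h

/-- The operator with its top eigenpair removed. -/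
noncomputable def deflate (T : CompactPositive H) : CompactPositive H :=
  ⟨T.1 - ‖T.1‖ • rankOne ℝ T.top T.top, by
    refine T.2.1.sub (IsCompactOperator.smul ?_ _)
    rw [rankOne_def']
    exact (isCompactOperator_of_locallyCompactSpace_rng
      (ContinuousLinearMap.toSpanSingleton ℝ T.top)).comp_clm (innerSL ℝ T.top),
    T.isPositive_sub_rankOne⟩

omit [CompleteSpace H] in
theorem norm_sub_inner_smul_le {e : H} (he : ‖e‖ = 1) (x : H) : ‖x - inner ℝ e x • e‖ ≤ ‖x‖ := by
  have : ‖x - inner ℝ e x • e‖ ^ 2 = ‖x‖ ^ 2 - inner ℝ e x ^ 2 := by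
    rw [norm_sub_sq_real, norm_smul, inner_smul_right, he, real_inner_comm]
    simp
    ring
  exact abs_le_of_sq_le_sq' (by nlinarith [sq_nonneg (inner ℝ e x)]) (norm_nonneg _) |>.2

theorem norm_deflate_le (T : CompactPositive H) : ‖T.deflate.1‖ ≤ ‖T.1‖ := by
  refine ContinuousLinearMap.opNorm_le_bound _ (norm_nonneg _) fun x => ?_
  rw [deflate, sub_rankOne_apply]
  rcases T.norm_top with ⟨-, h⟩ | h
  · exact (T.1.le_opNorm _).trans (by gcongr; exact norm_sub_inner_smul_le h x)
  · simp [h.1]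

theorem deflate_top (T : CompactPositive H) : T.deflate.1 T.top = 0 := by
  rw [deflate, sub_rankOne_apply, real_inner_self_eq_norm_sq]
  rcases T.norm_top with ⟨-, h⟩ | h <;> simp [h]

/-- A kernel vector satisfies `‖T‖ ⟪x, T.top⟫ = ⟪T x, T.top⟫ = 0`. Hence an eigenvector once removed
stays in the kernel of all later deflations, which makes the eigenvectors orthogonal. -/
theorem deflate_eq_zero (T : CompactPositive H) {x : H} (hx : T.1 x = 0) : T.deflate.1 x = 0 := by
  have h := T.inner_top x
  rw [hx, inner_zero_left, real_inner_comm] at h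
  simp [deflate, hx, smul_smul, ← h]

theorem iterate_deflate_top (T : CompactPositive H) {i j : ℕ} (hij : i < j) :
    (deflate^[j] T).1 (deflate^[i] T).top = 0 := by
  induction j, hij using Nat.le_induction with
  | base => rw [Function.iterate_succ_apply']; exact deflate_top _
  | succ j _ ih => rw [Function.iterate_succ_apply']; exact deflate_eq_zero _ ih

theorem inner_top_top (T : CompactPositive H) {i j : ℕ} (hij : i < j) :
    ‖(deflate^[j] T).1‖ * inner ℝ (deflate^[i] T).top (deflate^[j] T).top = 0 := by
  rw [← inner_top, iterate_deflate_top T hij, inner_zero_left]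

theorem eq_iterate_deflate_add_sum (T : CompactPositive H) (n : ℕ) :
    T.1 = (deflate^[n] T).1 + ∑ i ∈ Finset.range n,
      ‖(deflate^[i] T).1‖ • rankOne ℝ (deflate^[i] T).top (deflate^[i] T).top := by
  induction n with
  | zero => simp
  | succ n ih =>
    rw [Finset.sum_range_succ, Function.iterate_succ_apply']
    nth_rw 1 [ih]
    simp only [deflate]
    abel

theorem antitone_norm_iterate (T : CompactPositive H) :
    Antitone fun n => ‖(deflate^[n] T).1‖ :=
  antitone_nat_of_succ_le fun n => by
    rw [Function.iterate_succ_apply']; exact norm_deflate_le _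

end CompactPositive

/-- The spectral theorem for compact positive operators, with the eigenvalues enumerated in
decreasing order. -/
theorem exists_antitone_eigenvalues {T : H →L[ℝ] H} (hT : IsCompactOperator T)
    (hp : T.IsPositive) : ∃ (lam : ℕ → ℝ) (e : ℕ → H), (∀ i, 0 ≤ lam i) ∧ Antitone lam ∧
      Orthonormal ℝ (fun i : {i : ℕ // lam i ≠ 0} => e i) ∧ (∀ i, T (e i) = lam i • e i) ∧
      (∀ i, lam i = 0 → e i = 0) ∧
      ∀ n, ‖T - ∑ i ∈ Finset.range n, lam i • rankOne ℝ (e i) (e i)‖ = lam n := by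
  set S : CompactPositive H := ⟨T, hT, hp⟩
  have key := S.eq_iterate_deflate_add_sum
  have hz : ∀ i, ‖(CompactPositive.deflate^[i] S).1‖ = 0 →
      (CompactPositive.deflate^[i] S).top = 0 := fun i hi =>
    ((CompactPositive.deflate^[i] S).norm_top.resolve_left
      fun h => h.1 (norm_eq_zero.1 hi)).2
  have hlt : ∀ i j, i < j → inner ℝ (CompactPositive.deflate^[i] S).top
      (CompactPositive.deflate^[j] S).top = 0 := by
    intro i j hij
    rcases mul_eq_zero.1 (S.inner_top_top hij) with h | h
    · simp [hz j h]
    · exact h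
  refine ⟨fun n => ‖(CompactPositive.deflate^[n] S).1‖,
    fun n => (CompactPositive.deflate^[n] S).top, fun i => norm_nonneg _,
    S.antitone_norm_iterate, ⟨fun i => CompactPositive.norm_top_of_ne_zero _ i.2, ?_⟩, ?_, hz, ?_⟩
  · rintro ⟨i, hi⟩ ⟨j, hj⟩ hij
    rcases lt_or_gt_of_ne (fun h => hij (Subtype.ext h) : i ≠ j) with h | h
    · exact hlt _ _ h
    · rw [real_inner_comm]; exact hlt _ _ h
  · intro j
    -- At its own top vector the `j`-th deflation agrees with `T`: the rank-one terms removed before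
    -- are orthogonal to it.
    have h := congrArg (fun A : H →L[ℝ] H => A (CompactPositive.deflate^[j] S).top) (key j)
    simp only [_root_.add_apply, CompactPositive.apply_top,
      _root_.sum_apply, _root_.smul_apply, rankOne_apply] at h
    rw [Finset.sum_eq_zero, add_zero] at h
    · exact h
    · intro i hi
      rw [hlt i j (Finset.mem_range.1 hi)]
      simp
  · intro n
    have h := key n
    rw [← sub_eq_iff_eq_add] at h
    exact congrArg norm h

end CompactPositive

/-! ### Existence of Kosambi-Karhunen-Loève expansions -/

section KKLExistence

open InnerProductSpace

variable {S H : Type*} [MeasurableSpace S] [NormedAddCommGroup H] [InnerProductSpace ℝ H]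
  {P : Measure S} {U : S → H}

/-- Parseval's identity for an orthogonal series. -/
theorem HasSum.norm_sq_of_orthogonal {f : ℕ → H} (hf : ∀ i j, i ≠ j → inner ℝ (f i) (f j) = 0)
    {x : H} (hx : HasSum f x) : HasSum (fun i => ‖f i‖ ^ 2) (‖x‖ ^ 2) := by
  have h1 : ∀ i, inner ℝ (f i) x = ‖f i‖ ^ 2 := by
    intro i
    have h := hx.mapL (innerSL ℝ (f i))
    simp only [innerSL_apply_apply] at h
    rw [← real_inner_self_eq_norm_sq]
    exact h.unique (hasSum_single i fun j hj => hf i j hj.symm)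
  have h2 := hx.mapL (innerSL ℝ x)
  have h3 : ∀ i, inner ℝ x (f i) = ‖f i‖ ^ 2 := fun i => by rw [real_inner_comm, h1]
  simpa only [innerSL_apply_apply, h3, real_inner_self_eq_norm_sq] using h2

theorem norm_sum_sq_of_orthogonal {ι : Type*} {f : ι → H}
    (hf : ∀ i j, i ≠ j → inner ℝ (f i) (f j) = 0) (s : Finset ι) : ‖∑ i ∈ s, f i‖ ^ 2 = ∑ i ∈ s, ‖f i‖ ^ 2 := by
  rw [← real_inner_self_eq_norm_sq, sum_inner]
  refine Finset.sum_congr rfl fun i hi => ?_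
  rw [inner_sum, Finset.sum_eq_single i (fun j _ hj => hf i j hj.symm) (by simp [hi]),
    real_inner_self_eq_norm_sq]

/-- An orthogonal series with summable squared norms converges. -/
theorem summable_of_orthogonal [CompleteSpace H] {f : ℕ → H}
    (hf : ∀ i j, i ≠ j → inner ℝ (f i) (f j) = 0) (hs : Summable fun i => ‖f i‖ ^ 2) :
    Summable f := by
  rw [summable_iff_vanishing_norm] at hs ⊢
  intro ε hε
  obtain ⟨s, hs⟩ := hs (ε ^ 2) (by positivity)
  refine ⟨s, fun t ht => ?_⟩
  have h := hs t ht
  rw [← norm_sum_sq_of_orthogonal hf, Real.norm_of_nonneg (by positivity)] at h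
  exact lt_of_pow_lt_pow_left₀ 2 hε.le h

theorem MeasureTheory.MemLp.integrable_inner_mul_inner (hU : MemLp U 2 P) (x y : H) :
    Integrable (fun s => inner ℝ (U s) x * inner ℝ (U s) y) P :=
  (hU.inner_const x).integrable_mul (hU.inner_const y)

theorem MeasureTheory.MemLp.integrable_rankOne (hU : MemLp U 2 P) :
    Integrable (fun s => rankOne ℝ (U s) (U s)) P := by
  have hc : Continuous fun x : H => rankOne ℝ x x :=
    (rankOne ℝ (E := H) (F := H)).continuous.clm_apply continuous_id
  refine ((memLp_two_iff_integrable_sq_norm hU.1).1 hU).mono'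
    (hc.comp_aestronglyMeasurable hU.1) (ae_of_all _ fun s => ?_)
  simp [sq]

/-- The (uncentred) covariance operator of a random element of a Hilbert space. -/
noncomputable def secondMoment (P : Measure S) (U : S → H) : H →L[ℝ] H :=
  ∫ s, rankOne ℝ (U s) (U s) ∂P

variable [CompleteSpace H]

theorem inner_secondMoment (hU : MemLp U 2 P) (x y : H) :
    inner ℝ (secondMoment P U x) y = ∫ s, inner ℝ (U s) x * inner ℝ (U s) y ∂P := by
  rw [secondMoment, ContinuousLinearMap.integral_apply hU.integrable_rankOne, real_inner_comm,
    ← integral_inner (hU.integrable_rankOne.apply_continuousLinearMap x)]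
  simp only [rankOne_apply, inner_smul_right, real_inner_comm]

theorem isPositive_secondMoment (hU : MemLp U 2 P) : (secondMoment P U).IsPositive := by
  rw [ContinuousLinearMap.isPositive_iff]
  refine ⟨fun x y => ?_, fun x => ?_⟩
  · rw [ContinuousLinearMap.coe_coe, real_inner_comm _ x, inner_secondMoment hU,
      inner_secondMoment hU]
    simp only [mul_comm]
  · rw [inner_secondMoment hU]
    exact integral_nonneg fun s => mul_self_nonneg _

/-- An average of rank-one operators stays in the closed convex set of compact operators. -/
theorem isCompactOperator_secondMoment [IsProbabilityMeasure P] (hU : MemLp U 2 P) :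
    IsCompactOperator (secondMoment P U) := by
  refine Convex.integral_mem (s := {T : H →L[ℝ] H | IsCompactOperator T})
    (fun T hT R hR a b _ _ _ => ?_) isClosed_setOfPred_isCompactOperator
    (ae_of_all _ fun s => ?_) hU.integrable_rankOne
  · exact IsCompactOperator.add (hT.smul a) (hR.smul b)
  · rw [rankOne_def']
    exact (isCompactOperator_of_locallyCompactSpace_rng
      (ContinuousLinearMap.toSpanSingleton ℝ (U s))).comp_clm (innerSL ℝ (U s))

/-- The Kosambi-Karhunen-Loève theorem: a square-integrable random element of a Hilbert space has
an expansion. -/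
theorem exists_isKKLExpansion [IsProbabilityMeasure P] (hU : MemLp U 2 P) :
    ∃ (lam : ℕ → ℝ) (ω : ℕ → S → ℝ) (e : ℕ → H), IsKKLExpansion P U lam ω e := by
  obtain ⟨lam, e, hnn, hanti, horth, heig, hzero, htail⟩ :=
    exists_antitone_eigenvalues (isCompactOperator_secondMoment hU) (isPositive_secondMoment hU)
  have hij : ∀ i j, i ≠ j → inner ℝ (e i) (e j) = 0 := by
    intro i j hij
    by_cases hi : lam i = 0
    · simp [hzero i hi]
    by_cases hj : lam j = 0
    · simp [hzero j hj]
    exact horth.2 (i := ⟨i, hi⟩) (j := ⟨j, hj⟩) (fun h => hij (congrArg Subtype.val h))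
  have hnorm : ∀ i, lam i ≠ 0 → ‖e i‖ = 1 := fun i hi => horth.1 ⟨i, hi⟩
  have hmom : ∀ i j, ∫ s, inner ℝ (U s) (e i) * inner ℝ (U s) (e j) ∂P =
      lam i * inner ℝ (e i) (e j) := by
    intro i j
    rw [← inner_secondMoment hU, heig, inner_smul_left]
    rfl
  have horthx : ∀ (x : H) (i j : ℕ), i ≠ j →
      inner ℝ (inner ℝ x (e i) • e i) (inner ℝ x (e j) • e j) = 0 := by
    intro x i j h
    rw [inner_smul_left, inner_smul_right, hij i j h]
    simp
  -- Bessel's inequality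
  have hres : ∀ (n : ℕ) (x : H), ‖x - ∑ i ∈ Finset.range n, inner ℝ x (e i) • e i‖ ^ 2 =
      ‖x‖ ^ 2 - ∑ i ∈ Finset.range n, inner ℝ x (e i) ^ 2 := by
    intro n x
    have hsq : ∀ i, inner ℝ x (e i) ^ 2 * ‖e i‖ ^ 2 = inner ℝ x (e i) ^ 2 := by
      intro i
      by_cases hi : lam i = 0
      · simp [hzero i hi]
      · simp [hnorm i hi]
    have h2 : ‖∑ i ∈ Finset.range n, inner ℝ x (e i) • e i‖ ^ 2 =
        ∑ i ∈ Finset.range n, inner ℝ x (e i) ^ 2 := by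
      rw [norm_sum_sq_of_orthogonal (horthx x)]
      simp only [norm_smul, mul_pow, Real.norm_eq_abs, sq_abs, hsq]
    rw [norm_sub_sq_real, h2, inner_sum]
    simp only [inner_smul_right, ← sq]
    ring
  -- `λᵢ` is the second moment of the `i`-th coefficient, so Bessel's inequality bounds the partial
  -- sums by `𝔼‖U‖²`.
  have hsum : Summable lam := by
    refine summable_of_sum_range_le (c := ∫ s, ‖U s‖ ^ 2 ∂P) hnn fun n => ?_
    have h1 : ∀ i, lam i = ∫ s, inner ℝ (U s) (e i) ^ 2 ∂P := by
      intro i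
      simp only [sq]
      rw [hmom]
      by_cases hi : lam i = 0
      · simp [hi]
      · simp [hnorm i hi]
    have hint : ∀ i, Integrable (fun s => inner ℝ (U s) (e i) ^ 2) P := fun i => by
      simpa only [sq] using hU.integrable_inner_mul_inner (e i) (e i)
    rw [Finset.sum_congr rfl fun i _ => h1 i, ← integral_finsetSum _ fun i _ => hint i]
    refine integral_mono (integrable_finsetSum _ fun i _ => hint i)
      ((memLp_two_iff_integrable_sq_norm hU.1).1 hU) fun s => ?_
    have := hres n (U s)
    have h2 := sq_nonneg ‖U s - ∑ i ∈ Finset.range n, inner ℝ (U s) (e i) • e i‖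
    simp only
    linarith
  -- pointwise convergence of the expansion
  have hconv : ∀ x : H, Summable fun i => inner ℝ x (e i) • e i := by
    intro x
    refine summable_of_orthogonal (horthx x)
      (summable_of_sum_range_le (c := ‖x‖ ^ 2) (fun i => by positivity) fun n => ?_)
    rw [← norm_sum_sq_of_orthogonal (horthx x)]
    have h2 : inner ℝ (x - ∑ i ∈ Finset.range n, inner ℝ x (e i) • e i) x =
      ‖x - ∑ i ∈ Finset.range n, inner ℝ x (e i) • e i‖ ^ 2 := by
      rw [hres, inner_sub_left, sum_inner, real_inner_self_eq_norm_sq]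
      simp only [inner_smul_left, conj_trivial, real_inner_comm, ← sq]
    have h3 : ‖∑ i ∈ Finset.range n, inner ℝ x (e i) • e i‖ ^ 2 =
        ‖x‖ ^ 2 - ‖x - ∑ i ∈ Finset.range n, inner ℝ x (e i) • e i‖ ^ 2 := by
      have := norm_sub_sq_real x (x - ∑ i ∈ Finset.range n, inner ℝ x (e i) • e i)
      rw [sub_sub_cancel, real_inner_comm, h2] at this
      linarith
    nlinarith [sq_nonneg ‖x - ∑ i ∈ Finset.range n, inner ℝ x (e i) • e i‖]
  -- The remainder vanishes weakly: `𝔼⟪y, U - pₙ⟫²` is the quadratic form of the second moment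
  -- operator at `y` stripped of its first `n` modes, hence at most `λₙ‖y‖²`. Since the remainder
  -- almost surely lies in a separable set, vanishing against each `y` suffices.
  have hlim : ∀ᵐ s ∂P, ∑' i, inner ℝ (U s) (e i) • e i = U s := by
    set p : ℕ → S → H := fun n s => ∑ i ∈ Finset.range n, inner ℝ (U s) (e i) • e i
    have hpm : ∀ n, AEStronglyMeasurable (p n) P := fun n =>
      Finset.aestronglyMeasurable_fun_sum _ fun i _ =>
        (hU.inner_const (e i)).1.smul_const (e i)
    have hpt : ∀ s, Tendsto (fun n => p n s) atTop (𝓝 (∑' i, inner ℝ (U s) (e i) • e i)) :=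
      fun s => (hconv (U s)).hasSum.tendsto_sum_nat
    have hLm : AEStronglyMeasurable (fun s => ∑' i, inner ℝ (U s) (e i) • e i) P :=
      aestronglyMeasurable_of_tendsto_ae atTop hpm (ae_of_all _ hpt)
    have hRm := hU.1.sub hLm
    obtain ⟨t, ht, hRt⟩ := hRm.isSeparable_ae_range
    have hR0 : ∀ y : H, (fun s => inner ℝ y (U s - ∑' i, inner ℝ (U s) (e i) • e i)) =ᵐ[P] 0 := by
      intro y
      have hUsq := (memLp_two_iff_integrable_sq_norm hU.1).1 hU
      have hRle : ∀ n s, ‖U s - p n s‖ ≤ ‖U s‖ := by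
        intro n s
        have h1 := hres n (U s)
        have h2 : 0 ≤ ∑ i ∈ Finset.range n, inner ℝ (U s) (e i) ^ 2 :=
          Finset.sum_nonneg fun i _ => sq_nonneg _
        exact (abs_le_of_sq_le_sq' (by simp only [p]; linarith) (norm_nonneg _)).2
      have hle : ∀ n s, (inner ℝ y (U s - p n s)) ^ 2 ≤ ‖y‖ ^ 2 * ‖U s‖ ^ 2 := by
        intro n s
        rw [← sq_abs, ← mul_pow]
        gcongr
        exact (abs_real_inner_le_norm _ _).trans (by gcongr; exact hRle n s)
      have hl1 : Tendsto (fun n => ∫ s, (inner ℝ y (U s - p n s)) ^ 2 ∂P) atTop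
          (𝓝 (∫ s, (inner ℝ y (U s - ∑' i, inner ℝ (U s) (e i) • e i)) ^ 2 ∂P)) := by
        refine tendsto_integral_of_dominated_convergence (fun s => ‖y‖ ^ 2 * ‖U s‖ ^ 2)
          (fun n => ((hU.1.sub (hpm n)).const_inner).pow 2) (hUsq.const_mul _)
          (fun n => ae_of_all _ fun s => ?_) (ae_of_all _ fun s => ?_)
        · rw [Real.norm_of_nonneg (sq_nonneg _)]
          exact hle n s
        · exact (tendsto_const_nhds.inner (tendsto_const_nhds.sub (hpt s))).pow 2
      have hbound : ∀ n, ∫ s, (inner ℝ y (U s - p n s)) ^ 2 ∂P ≤ lam n * ‖y‖ * ‖y‖ := by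
        intro n
        set yn := y - ∑ i ∈ Finset.range n, inner ℝ y (e i) • e i
        have h1 : ∀ s, inner ℝ y (U s - p n s) = inner ℝ (U s) yn := by
          intro s
          simp only [p, yn, inner_sub_right, inner_sum, inner_smul_right, real_inner_comm]
          congr 1
          exact Finset.sum_congr rfl fun i _ => mul_comm _ _
        have h2 : secondMoment P U yn = (secondMoment P U -
            ∑ i ∈ Finset.range n, lam i • rankOne ℝ (e i) (e i)) y := by
          simp only [yn, map_sub, map_sum, map_smul, heig, _root_.sub_apply, _root_.sum_apply,
            _root_.smul_apply, rankOne_apply]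
          congr 1
          exact Finset.sum_congr rfl fun i _ => by rw [smul_comm, real_inner_comm]
        simp only [h1, sq]
        rw [← inner_secondMoment hU, h2]
        refine (real_inner_le_norm _ _).trans ?_
        have h3 := ContinuousLinearMap.le_opNorm (secondMoment P U -
            ∑ i ∈ Finset.range n, lam i • rankOne ℝ (e i) (e i)) y
        rw [htail] at h3
        have h4 : ‖yn‖ ≤ ‖y‖ := by
          have h1 := hres n y
          have h2 : 0 ≤ ∑ i ∈ Finset.range n, inner ℝ y (e i) ^ 2 :=
            Finset.sum_nonneg fun i _ => sq_nonneg _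
          exact (abs_le_of_sq_le_sq' (by simp only [yn]; linarith) (norm_nonneg _)).2
        have h5 := hnn n
        gcongr
      have hl2 : Tendsto (fun n => ∫ s, (inner ℝ y (U s - p n s)) ^ 2 ∂P) atTop (𝓝 0) := by
        refine squeeze_zero (fun n => integral_nonneg fun s => sq_nonneg _) hbound ?_
        simpa using (hsum.tendsto_atTop_zero.mul_const ‖y‖).mul_const ‖y‖
      have h0 := tendsto_nhds_unique hl1 hl2
      have hint : Integrable
          (fun s => (inner ℝ y (U s - ∑' i, inner ℝ (U s) (e i) • e i)) ^ 2) P := by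
        refine (hUsq.const_mul (‖y‖ ^ 2)).mono' (hRm.const_inner.pow 2)
          (ae_of_all _ fun s => ?_)
        rw [Real.norm_of_nonneg (sq_nonneg _)]
        exact le_of_tendsto' ((tendsto_const_nhds.inner (tendsto_const_nhds.sub (hpt s))).pow 2)
          fun n => hle n s
      rw [integral_eq_zero_iff_of_nonneg (fun s => sq_nonneg _) hint] at h0
      filter_upwards [h0] with s hs
      simpa using hs
    have := ae_eq_zero_of_forall_dual_of_isSeparable ℝ ht (f := fun s => U s -
      ∑' i, inner ℝ (U s) (e i) • e i) (fun c => ?_) hRt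
    · filter_upwards [this] with s hs
      exact (sub_eq_zero.1 hs).symm
    · filter_upwards [hR0 ((toDual ℝ H).symm c)] with s hs
      simpa using hs
  -- Where `λᵢ = 0` the inverse is `0` by convention, and the mode `e i` is `0` as well.
  refine ⟨lam, fun i s => (√(lam i))⁻¹ * inner ℝ (U s) (e i), e, hnn, hanti, hsum, horth,
    fun i _ => (hU.inner_const (e i)).const_mul _, fun i j hi hj => ?_, ?_⟩
  · have : ∀ s, (√(lam i))⁻¹ * inner ℝ (U s) (e i) * ((√(lam j))⁻¹ * inner ℝ (U s) (e j)) =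
      (√(lam i))⁻¹ * (√(lam j))⁻¹ * (inner ℝ (U s) (e i) * inner ℝ (U s) (e j)) :=
      fun s => by ring
    simp only [this]
    rw [integral_const_mul, hmom]
    split_ifs with h
    · subst h
      rw [real_inner_self_eq_norm_sq, hnorm i hi, ← mul_inv, Real.mul_self_sqrt (hnn i)]
      field_simp
    · rw [hij i j h]; simp
  · filter_upwards [hlim] with s hs
    convert (hconv (U s)).hasSum using 1
    · funext i
      by_cases hi : lam i = 0
      · simp [hzero i hi]
      · rw [← mul_assoc, mul_inv_cancel₀ (Real.sqrt_ne_zero'.2 (lt_of_le_of_ne (hnn i) (Ne.symm hi))),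
          one_mul]
    · exact hs.symm

end KKLExistence

/-! ### Weak and strong measurability -/

section Pettis

/-- A weakly measurable function into a separable Hilbert space is strongly measurable. -/
theorem aestronglyMeasurable_of_inner {S H : Type*} [MeasurableSpace S] {P : Measure S}
    [NormedAddCommGroup H] [InnerProductSpace ℝ H] [CompleteSpace H]
    [TopologicalSpace.SeparableSpace H] {f : S → H}
    (hf : ∀ y : H, AEStronglyMeasurable (fun s => inner ℝ y (f s)) P) :
    AEStronglyMeasurable f P := by
  obtain ⟨w, b, hb⟩ := exists_hilbertBasis ℝ H
  -- Distinct basis vectors are `√2` apart, so the balls of radius `1/2` around them are disjoint.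
  have hcount : Countable w := by
    refine Pairwise.countable_of_isOpen_disjoint (s := fun i : w => Metric.ball (b i) (1 / 2))
      (fun i j hij => ?_) (fun i => Metric.isOpen_ball)
      (fun i => ⟨b i, Metric.mem_ball_self (by norm_num)⟩)
    refine Metric.ball_disjoint_ball ?_
    have h1 := norm_sub_sq_real (b i) (b j)
    rw [b.orthonormal.2 hij, b.orthonormal.1, b.orthonormal.1] at h1
    rw [dist_eq_norm]
    nlinarith [norm_nonneg (b i - b j)]
  refine aestronglyMeasurable_of_tendsto_ae (atTop : Filter (Finset w))
    (f := fun t s => ∑ i ∈ t, inner ℝ (b i) (f s) • b i)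
    (fun t => Finset.aestronglyMeasurable_fun_sum _ fun i _ => (hf _).smul_const _)
    (ae_of_all _ fun s => ?_)
  have h := b.hasSum_repr (f s)
  simp only [b.repr_apply_apply] at h
  exact h

end Pettis

/-! ### Limits and integrals of Gaussian variables -/

section GaussianLimit

variable {S : Type*} [MeasurableSpace S] {P : Measure S} [IsProbabilityMeasure P]

/-- An almost sure limit of Gaussian random variables whose means converge is Gaussian. -/
theorem hasGaussianLaw_of_tendsto_ae {Y : ℕ → S → ℝ} {Z : S → ℝ} {m : ℝ}
    (hY : ∀ n, HasGaussianLaw (Y n) P) (hm : Tendsto (fun n => ∫ s, Y n s ∂P) atTop (𝓝 m))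
    (hYZ : ∀ᵐ s ∂P, Tendsto (fun n => Y n s) atTop (𝓝 (Z s))) : HasGaussianLaw Z P := by
  have hZm : AEMeasurable Z P := aemeasurable_of_tendsto_metrizable_ae atTop
    (fun n => (hY n).aemeasurable) hYZ
  have hZp : IsProbabilityMeasure (P.map Z) := Measure.isProbabilityMeasure_map hZm
  have hchar : ∀ t : ℝ, Tendsto (fun n => charFun (P.map (Y n)) t) atTop
      (𝓝 (charFun (P.map Z) t)) := by
    intro t
    simp only [charFun_apply_real]
    rw [integral_map hZm (by fun_prop)]
    simp_rw [fun n => integral_map (hY n).aemeasurable (f := fun x : ℝ =>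
      Complex.exp (t * x * Complex.I)) (by fun_prop)]
    refine tendsto_integral_of_dominated_convergence (fun _ => (1 : ℝ)) (fun n => ?_)
      (integrable_const _) (fun n => ae_of_all _ fun s => ?_) ?_
    · exact ((by fun_prop : Continuous fun x : ℝ => Complex.exp (t * x * Complex.I)).measurable
        |>.comp_aemeasurable (hY n).aemeasurable).aestronglyMeasurable
    · rw [← Complex.ofReal_mul, Complex.norm_exp_ofReal_mul_I]
    · filter_upwards [hYZ] with s hs
      exact ((by fun_prop : Continuous fun x : ℝ =>
        Complex.exp (t * x * Complex.I)).tendsto _).comp hs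
  set v : ℕ → ℝ := fun n => Var[Y n; P]
  have hv0 : ∀ n, 0 ≤ v n := fun n => variance_nonneg _ _
  have hform : ∀ n t, charFun (P.map (Y n)) t =
      Complex.exp (t * (∫ s, Y n s ∂P : ℝ) * Complex.I - (v n : ℂ) * t ^ 2 / 2) := by
    intro n t
    rw [(hY n).map_eq_gaussianReal, charFun_gaussianReal, Real.coe_toNNReal _ (hv0 n)]
  have hnorm : ∀ n t, ‖charFun (P.map (Y n)) t‖ = Real.exp (-(v n * t ^ 2 / 2)) := by
    intro n t
    rw [hform, Complex.norm_exp]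
    congr 1
    have : (t * (∫ s, Y n s ∂P : ℝ) * Complex.I - (v n : ℂ) * t ^ 2 / 2 : ℂ) =
      ((t * (∫ s, Y n s ∂P) : ℝ) : ℂ) * Complex.I - ((v n * t ^ 2 / 2 : ℝ) : ℂ) := by
      push_cast; ring
    rw [this, Complex.sub_re, Complex.re_ofReal_mul, Complex.I_re, Complex.ofReal_re]
    ring
  -- At one `t ≠ 0` where the limiting characteristic function does not vanish, the logarithm of its
  -- modulus recovers the limit of the variances.
  obtain ⟨t, ht0, htne⟩ : ∃ t : ℝ, t ≠ 0 ∧ charFun (P.map Z) t ≠ 0 := by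
    have hcont : ContinuousAt (charFun (P.map Z)) 0 := continuous_charFun.continuousAt
    have h1 : ∀ᶠ t in 𝓝 (0 : ℝ), charFun (P.map Z) t ≠ 0 :=
      hcont.eventually_ne (by simp [charFun_zero])
    have h2 := (h1.filter_mono nhdsWithin_le_nhds).and
      (self_mem_nhdsWithin : {(0 : ℝ)}ᶜ ∈ 𝓝[≠] (0 : ℝ))
    obtain ⟨t, ht⟩ := h2.exists
    exact ⟨t, ht.2, ht.1⟩
  obtain ⟨v', hv'⟩ : ∃ v', Tendsto v atTop (𝓝 v') := by
    have h1 := ((hchar t).norm.log (norm_ne_zero_iff.2 htne)).const_mul (-2 / t ^ 2)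
    refine ⟨_, h1.congr fun n => ?_⟩
    rw [hnorm, Real.log_exp]
    field_simp
  have hv'0 : 0 ≤ v' := ge_of_tendsto' hv' hv0
  have heq : P.map Z = gaussianReal m v'.toNNReal := by
    refine Measure.ext_of_charFun (funext fun t => tendsto_nhds_unique (hchar t) ?_)
    rw [charFun_gaussianReal, Real.coe_toNNReal _ hv'0]
    simp only [hform]
    refine (Complex.continuous_exp.tendsto _).comp ?_
    refine Tendsto.sub ((tendsto_const_nhds.mul ?_).mul_const _) ((Tendsto.mul_const _ ?_).div_const _)
    · exact (Complex.continuous_ofReal.tendsto _).comp hm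
    · exact (Complex.continuous_ofReal.tendsto _).comp hv'
  exact ⟨by rw [heq]; infer_instance⟩

/-- The integral of a jointly measurable Gaussian process over its index set is Gaussian: by the
strong law of large numbers it is an almost sure limit of empirical means of the process over
independent random points. -/
theorem ProbabilityTheory.IsGaussianProcess.hasGaussianLaw_integral {α : Type*}
    [MeasurableSpace α] {ν : Measure α} [IsProbabilityMeasure ν] {g : α → S → ℝ}
    (hg : IsGaussianProcess g P) (hgm : Measurable (fun p : α × S => g p.1 p.2))
    (hmean : Integrable (fun x => ∫ s, g x s ∂P) ν) (hint : ∀ᵐ s ∂P, Integrable (g · s) ν) :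
    HasGaussianLaw (fun s => ∫ x, g x s ∂ν) P := by
  have hslln : ∀ f : α → ℝ, Measurable f → Integrable f ν →
      ∀ᵐ ξ ∂(Measure.infinitePi fun _ : ℕ => ν), Tendsto (fun n : ℕ =>
        (∑ i ∈ Finset.range n, f (ξ i)) / n) atTop (𝓝 (∫ x, f x ∂ν)) := by
    intro f hf hfi
    have hmp : ∀ i : ℕ, MeasurePreserving (Function.eval i)
        (Measure.infinitePi fun _ : ℕ => ν) ν :=
      fun i => measurePreserving_eval_infinitePi (fun _ : ℕ => ν) i
    have h := strong_law_ae_real (μ := Measure.infinitePi fun _ : ℕ => ν)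
      (fun i ξ => f (ξ i)) ((hmp 0).integrable_comp_of_integrable hfi)
      (fun i j hij => (iIndepFun_infinitePi (P := fun _ : ℕ => ν) (X := fun _ => f)
        fun _ => hf).indepFun hij)
      (fun i => ⟨(hf.comp (measurable_pi_apply i)).aemeasurable,
        (hf.comp (measurable_pi_apply 0)).aemeasurable, by
        rw [show (fun ξ : ℕ → α => f (ξ i)) = f ∘ Function.eval i from rfl,
          show (fun ξ : ℕ → α => f (ξ 0)) = f ∘ Function.eval 0 from rfl,
          ← Measure.map_map hf (hmp i).measurable, ← Measure.map_map hf (hmp 0).measurable,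
          (hmp i).map_eq, (hmp 0).map_eq]⟩)
    have h0 := integral_map (hmp 0).measurable.aemeasurable (f := f)
      (by rw [(hmp 0).map_eq]; exact hf.aestronglyMeasurable)
    rw [(hmp 0).map_eq] at h0
    rw [h0]
    exact h
  have hmm : Measurable (fun x => ∫ s, g x s ∂P) :=
    (hgm.stronglyMeasurable.integral_prod_right' (ν := P)).measurable
  have hIm : Measurable (fun s => ∫ x, g x s ∂ν) :=
    ((hgm.comp measurable_swap).stronglyMeasurable.integral_prod_right' (ν := ν)).measurable
  have hset : MeasurableSet {p : S × (ℕ → α) | Tendsto (fun n : ℕ =>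
      (∑ i ∈ Finset.range n, g (p.2 i) p.1) / n) atTop (𝓝 (∫ x, g x p.1 ∂ν))} := by
    refine measurableSet_tendsto_fun (fun n => ?_) (hIm.comp measurable_fst)
    refine (Finset.measurable_fun_sum _ fun i _ => ?_).div_const _
    have : Measurable fun p : S × (ℕ → α) => (p.2 i, p.1) := by fun_prop
    exact hgm.comp this
  have h1 : ∀ᵐ s ∂P, ∀ᵐ ξ ∂(Measure.infinitePi fun _ : ℕ => ν), Tendsto (fun n : ℕ =>
      (∑ i ∈ Finset.range n, g (ξ i) s) / n) atTop (𝓝 (∫ x, g x s ∂ν)) := by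
    filter_upwards [hint] with s hs
    exact hslln _ (hgm.comp (measurable_id.prodMk measurable_const)) hs
  -- Exchanging the quantifiers yields a single sequence of points `ξ` along which the empirical
  -- means converge for almost every `s`.
  rw [Measure.ae_ae_comm hset] at h1
  have h2 := h1.and (hslln _ hmm hmean)
  obtain ⟨ξ, hξ1, hξ2⟩ := h2.exists
  refine hasGaussianLaw_of_tendsto_ae (m := ∫ x, ∫ s, g x s ∂P ∂ν) (fun n => ?_) ?_ hξ1
  · have h := (hg.comp_right ξ).hasGaussianLaw_fun_sum (I := Finset.range n)
    have h' := h.fun_smul (n : ℝ)⁻¹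
    refine h'.congr (ae_of_all _ fun s => ?_)
    simp [div_eq_inv_mul]
  · refine hξ2.congr fun n => ?_
    rw [integral_div, integral_finsetSum]
    exact fun i _ => (hg.hasGaussianLaw_eval (ξ i)).integrable

end GaussianLimit

/-! ### Gaussian fields as random elements of `L²` -/

section GaussianField

variable {α S : Type*} [MeasurableSpace α] [MeasurableSpace S] {ν : Measure α} {P : Measure S}
  [IsProbabilityMeasure P] {X : α → S → ℝ} {μ : S → Lp ℝ 2 ν}

/-- The Lebesgue-space inner product of a test function with a random field is Gaussian. -/
theorem hasGaussianLaw_inner_field [IsFiniteMeasure ν] [NeZero ν] (hX : IsGaussianProcess X P)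
    (hXm : Measurable (fun p : α × S => X p.1 p.2))
    (hmean : MemLp (fun x => ∫ s, X x s ∂P) 2 ν)
    (hμ : ∀ᵐ s ∂P, (fun x => X x s) =ᵐ[ν] μ s) (f : Lp ℝ 2 ν) :
    HasGaussianLaw (fun s => inner ℝ f (μ s)) P := by
  set f' : α → ℝ := (Lp.stronglyMeasurable f).measurable.aemeasurable.mk f
  have hff' : f =ᵐ[ν] f' := (Lp.stronglyMeasurable f).measurable.aemeasurable.ae_eq_mk
  have hf'm : Measurable f' := AEMeasurable.measurable_mk _
  have hf'2 : MemLp f' 2 ν := (Lp.memLp f).ae_eq hff'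
  -- Sampling random points requires a probability measure; the factor `c` is undone at the end.
  set c : ℝ≥0∞ := (ν Set.univ)⁻¹
  have hνu : ν Set.univ ≠ 0 := (NeZero.ne ν) ∘ Measure.measure_univ_eq_zero.1
  have hc : c ≠ ∞ := ENNReal.inv_ne_top.2 hνu
  have hc0 : c.toReal ≠ 0 :=
    (ENNReal.toReal_pos (ENNReal.inv_ne_zero.2 (measure_ne_top _ _)) hc).ne'
  have hprob : IsProbabilityMeasure (c • ν) := ⟨by
    simp [c]⟩
  have hint : ∀ᵐ s ∂P, Integrable (fun x => f' x * X x s) ν := by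
    filter_upwards [hμ] with s hs
    exact hf'2.integrable_mul ((Lp.memLp (μ s)).ae_eq hs.symm)
  have key := (hX.smul f').hasGaussianLaw_integral (ν := c • ν)
    ((hf'm.comp measurable_fst).mul hXm)
    (by
      simp only [smul_eq_mul, integral_const_mul]
      exact (hf'2.integrable_mul hmean).smul_measure hc)
    (by
      filter_upwards [hint] with s hs
      exact hs.smul_measure hc)
  refine (key.fun_smul c.toReal⁻¹).congr ?_
  filter_upwards [hμ] with s hs
  simp only [smul_eq_mul, integral_smul_measure, inv_mul_cancel_left₀ hc0, L2.inner_def]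
  refine integral_congr_ae ?_
  filter_upwards [hs, hff'] with x h1 h2
  simp [← h1, h2, mul_comm]

variable [TopologicalSpace.SeparableSpace (Lp ℝ 2 ν)]

theorem aestronglyMeasurable_field [IsFiniteMeasure ν] [NeZero ν] (hX : IsGaussianProcess X P)
    (hXm : Measurable (fun p : α × S => X p.1 p.2))
    (hmean : MemLp (fun x => ∫ s, X x s ∂P) 2 ν)
    (hμ : ∀ᵐ s ∂P, (fun x => X x s) =ᵐ[ν] μ s) : AEStronglyMeasurable μ P :=
  aestronglyMeasurable_of_inner fun f =>
    (hasGaussianLaw_inner_field hX hXm hmean hμ f).aemeasurable.aestronglyMeasurable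

/-- Fernique's theorem for a Gaussian random field with square-integrable trajectories. -/
theorem exists_integrable_exp_sq_field [IsFiniteMeasure ν] [NeZero ν]
    (hX : IsGaussianProcess X P) (hXm : Measurable (fun p : α × S => X p.1 p.2))
    (hmean : MemLp (fun x => ∫ s, X x s ∂P) 2 ν)
    (hμ : ∀ᵐ s ∂P, (fun x => X x s) =ᵐ[ν] μ s) :
    ∃ C, 0 < C ∧ Integrable (fun s => Real.exp (C * ‖μ s‖ ^ 2)) P := by
  let _ : MeasurableSpace (Lp ℝ 2 ν) := borel _
  have : BorelSpace (Lp ℝ 2 ν) := ⟨rfl⟩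
  have : SecondCountableTopology (Lp ℝ 2 ν) := UniformSpace.secondCountable_of_separable _
  have hm : AEMeasurable μ P := (aestronglyMeasurable_field hX hXm hmean hμ).aemeasurable
  have : IsProbabilityMeasure (P.map μ) := Measure.isProbabilityMeasure_map hm
  have : IsGaussian (P.map μ) := by
    refine ⟨fun L => ?_⟩
    have hL : HasGaussianLaw (fun s => L (μ s)) P := by
      refine (hasGaussianLaw_inner_field hX hXm hmean hμ
        ((InnerProductSpace.toDual ℝ _).symm L)).congr (ae_of_all _ fun s => ?_)
      simp
    rw [AEMeasurable.map_map_of_aemeasurable L.continuous.measurable.aemeasurable hm,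
      integral_map hm L.continuous.aestronglyMeasurable,
      variance_map L.continuous.measurable.aemeasurable hm]
    exact hL.map_eq_gaussianReal
  obtain ⟨C, hC, hint⟩ := IsGaussian.exists_integrable_exp_sq (P.map μ)
  exact ⟨C, hC, (integrable_map_measure (by fun_prop) hm).1 hint⟩

/-- A Gaussian random field has exponential moments. -/
theorem integrable_exp_mul_norm_field [IsFiniteMeasure ν] [NeZero ν]
    (hX : IsGaussianProcess X P) (hXm : Measurable (fun p : α × S => X p.1 p.2))
    (hmean : MemLp (fun x => ∫ s, X x s ∂P) 2 ν)
    (hμ : ∀ᵐ s ∂P, (fun x => X x s) =ᵐ[ν] μ s) (c : ℝ) :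
    Integrable (fun s => Real.exp (c * ‖μ s‖)) P := by
  obtain ⟨C, hC, hint⟩ := exists_integrable_exp_sq_field hX hXm hmean hμ
  have hm := aestronglyMeasurable_field hX hXm hmean hμ
  refine (hint.const_mul (Real.exp (c ^ 2 / (4 * C)))).mono' ?_ (ae_of_all _ fun s => ?_)
  · exact (by fun_prop : Continuous fun x : Lp ℝ 2 ν =>
      Real.exp (c * ‖x‖)).comp_aestronglyMeasurable hm
  · rw [Real.norm_of_nonneg (Real.exp_pos _).le, ← Real.exp_add, Real.exp_le_exp]
    have h : c ^ 2 / (4 * C) + C * ‖μ s‖ ^ 2 - c * ‖μ s‖ = C * (‖μ s‖ - c / (2 * C)) ^ 2 := by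
      field_simp
      ring
    have : 0 ≤ C * (‖μ s‖ - c / (2 * C)) ^ 2 := by positivity
    linarith

end GaussianField

/-! ### The Lebesgue measure of the domain -/

section Domain

variable {d : ℕ} {Ω : Set (EuclideanSpace ℝ (Fin d))}

theorem isFiniteMeasure_lebesgueOn (ho : IsOpen Ω) (hb : Bornology.IsBounded Ω) :
    IsFiniteMeasure (lebesgueOn Ω) := ⟨by
  rw [lebesgueOn, comap_subtype_coe_apply ho.measurableSet]
  exact (measure_mono (by simp)).trans_lt hb.measure_lt_top⟩

theorem neZero_lebesgueOn (ho : IsOpen Ω) (hne : Ω.Nonempty) : NeZero (lebesgueOn Ω) := ⟨by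
  intro h
  have h1 : lebesgueOn Ω Set.univ = 0 := by rw [h]; rfl
  rw [lebesgueOn, comap_subtype_coe_apply ho.measurableSet] at h1
  exact (ho.measure_pos volume hne).ne' (by simpa using h1)⟩

theorem separableSpace_L2 (ho : IsOpen Ω) (hb : Bornology.IsBounded Ω) :
    TopologicalSpace.SeparableSpace (L2 Ω) := by
  have := isFiniteMeasure_lebesgueOn ho hb
  have : Fact ((2 : ℝ≥0∞) ≠ ∞) := ⟨by norm_num⟩
  infer_instance

end Domain

/-! ### Local variation and the mean value inequality -/

section LocalVariation

variable {W V : Type*} [NormedAddCommGroup W] [NormedAddCommGroup V] {G : W → V}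

theorem eventually_norm_sub_le_of_localVariation_le {w : W} {K r : ℝ}
    (h : localVariation G w ≤ ENNReal.ofReal K) (hr : K < r) (hr0 : 0 < r) :
    ∀ᶠ z in 𝓝 (0 : W), ‖G (w + z) - G w‖ ≤ r * ‖z‖ := by
  have h1 : localVariation G w < ENNReal.ofReal r :=
    h.trans_lt ((ENNReal.ofReal_lt_ofReal_iff hr0).2 hr)
  have h2 := eventually_nhdsWithin_iff.1 (eventually_lt_of_limsup_lt h1)
  filter_upwards [h2] with z hz
  by_cases hz0 : z = 0
  · simp [hz0]
  have h3 := hz hz0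
  have hzn : 0 < ‖z‖ := norm_pos_iff.2 hz0
  rw [← ofReal_norm, ← ofReal_norm, ← ENNReal.ofReal_div_of_pos hzn,
    ENNReal.ofReal_lt_ofReal_iff hr0, div_lt_iff₀ hzn] at h3
  exact h3.le

theorem continuousAt_of_localVariation_le {w : W} {K : ℝ}
    (h : localVariation G w ≤ ENNReal.ofReal K) : ContinuousAt G w := by
  have h1 := eventually_norm_sub_le_of_localVariation_le h
    (r := |K| + 1) (by linarith [le_abs_self K]) (by positivity)
  rw [ContinuousAt, tendsto_iff_norm_sub_tendsto_zero]
  have h2 : Tendsto (fun z => z - w) (𝓝 w) (𝓝 0) := by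
    have := (continuous_sub_right w).tendsto w
    rwa [sub_self] at this
  refine squeeze_zero' (Eventually.of_forall fun _ => norm_nonneg _)
    (g := fun z => (|K| + 1) * ‖z - w‖) ?_ ?_
  · filter_upwards [h2.eventually h1] with z hz
    simpa using hz
  · simpa using h2.norm.const_mul (|K| + 1)

theorem localVariation_le_of_lipschitz {L : ℝ} (hL : 0 ≤ L)
    (h : ∀ x y, ‖G x - G y‖ ≤ L * ‖x - y‖) (w : W) : localVariation G w ≤ ENNReal.ofReal L := by
  refine limsup_le_of_le (by isBoundedDefault) (Eventually.of_forall fun z => ?_)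
  refine ENNReal.div_le_of_le_mul ?_
  have h1 := h (w + z) w
  rw [add_sub_cancel_left] at h1
  rw [← ofReal_norm, ← ofReal_norm, ← ENNReal.ofReal_mul hL]
  exact ENNReal.ofReal_le_ofReal h1

theorem continuous_of_localVariation_le_exp {A β : ℝ}
    (hG : ∀ w, localVariation G w ≤ ENNReal.ofReal (A * Real.exp (β * ‖w‖))) : Continuous G :=
  continuous_iff_continuousAt.2 fun w => continuousAt_of_localVariation_le (hG w)

variable [NormedSpace ℝ W]

/-- The mean value inequality for the local variation. -/
theorem norm_sub_le_of_localVariation_le {K : ℝ} (hK : 0 ≤ K) {s : Set W}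
    (hs : Convex ℝ s) (h : ∀ w ∈ s, localVariation G w ≤ ENNReal.ofReal K) {x y : W}
    (hx : x ∈ s) (hy : y ∈ s) : ‖G y - G x‖ ≤ K * ‖y - x‖ := by
  by_cases hxy : y = x
  · simp [hxy]
  have hpos : 0 < ‖y - x‖ := norm_pos_iff.2 (sub_ne_zero.2 hxy)
  have hmem : ∀ t ∈ Set.Icc (0 : ℝ) 1, x + t • (y - x) ∈ s := fun t ht =>
    hs.add_smul_sub_mem hx hy ht
  refine le_of_forall_pos_le_add fun ε hε => ?_
  -- Comparison along the segment with the barrier `(K‖y - x‖ + ε) t`. Only right slopes enter, so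
  -- no differentiability is needed; `ε` supplies the strict inequality of slopes.
  have key := image_norm_le_of_liminf_right_slope_norm_lt_deriv_boundary (a := 0) (b := 1)
    (f := fun t : ℝ => G (x + t • (y - x)) - G x) (f' := fun _ => K * ‖y - x‖)
    (B := fun t => (K * ‖y - x‖ + ε) * t) (B' := fun _ => K * ‖y - x‖ + ε)
    ?_ ?_ (by simp) (by fun_prop) ?_ (fun t _ _ => by linarith)
    (Set.right_mem_Icc.2 zero_le_one)
  · simpa using key
  · intro t ht
    refine ContinuousAt.continuousWithinAt ?_
    refine ContinuousAt.sub ?_ continuousAt_const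
    exact ContinuousAt.comp (f := fun t : ℝ => x + t • (y - x))
      (continuousAt_of_localVariation_le (h _ (hmem t ht))) (by fun_prop)
  · intro t ht r hr
    obtain ⟨r', hr1, hr2⟩ := exists_between ((lt_div_iff₀ hpos).2 hr)
    have h1 := eventually_norm_sub_le_of_localVariation_le
      (h _ (hmem t (Set.Ico_subset_Icc_self ht))) hr1 (hK.trans_lt hr1)
    have h2 : Tendsto (fun z : ℝ => (z - t) • (y - x)) (𝓝[>] t) (𝓝 0) := by
      have : ContinuousAt (fun z : ℝ => (z - t) • (y - x)) t := by fun_prop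
      have h3 := this.tendsto
      simp only [sub_self, zero_smul] at h3
      exact h3.mono_left nhdsWithin_le_nhds
    refine Eventually.frequently ?_
    filter_upwards [h2.eventually h1, self_mem_nhdsWithin] with z hz hzt
    have hzt' : 0 < z - t := sub_pos.2 hzt
    rw [slope_def_field, div_lt_iff₀ hzt']
    have h4 : x + t • (y - x) + (z - t) • (y - x) = x + z • (y - x) := by
      rw [add_assoc, ← add_smul]; congr 2; ring
    rw [h4, norm_smul, Real.norm_of_nonneg hzt'.le] at hz
    calc (norm ∘ fun t : ℝ => G (x + t • (y - x)) - G x) z -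
          (norm ∘ fun t : ℝ => G (x + t • (y - x)) - G x) t
        ≤ ‖(G (x + z • (y - x)) - G x) - (G (x + t • (y - x)) - G x)‖ := norm_sub_norm_le _ _
      _ = ‖G (x + z • (y - x)) - G (x + t • (y - x))‖ := by rw [sub_sub_sub_cancel_right]
      _ ≤ r' * ((z - t) * ‖y - x‖) := hz
      _ = (r' * ‖y - x‖) * (z - t) := by ring
      _ < r * (z - t) := by
        gcongr
        exact (lt_div_iff₀ hpos).1 hr2
  · intro t _
    simpa using ((hasDerivAt_id t).const_mul (K * ‖y - x‖ + ε)).hasDerivWithinAt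

/-- The ball of radius `R` is convex and the local variation on it is at most `A exp (β R)`. -/
theorem norm_sub_le_of_localVariation_le_exp {A β : ℝ} (hA : 0 < A) (hβ : 0 < β)
    (hG : ∀ w, localVariation G w ≤ ENNReal.ofReal (A * Real.exp (β * ‖w‖))) {R : ℝ} {x y : W}
    (hx : ‖x‖ ≤ R) (hy : ‖y‖ ≤ R) : ‖G x - G y‖ ≤ A * Real.exp (β * R) * ‖x - y‖ := by
  refine norm_sub_le_of_localVariation_le (by positivity) (convex_closedBall (0 : W) R)
    (fun w hw => (hG w).trans (ENNReal.ofReal_le_ofReal ?_))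
    (mem_closedBall_zero_iff.2 hy) (mem_closedBall_zero_iff.2 hx)
  have := mem_closedBall_zero_iff.1 hw
  gcongr

end LocalVariation

/-! ### Square integrability from exponential moments -/

section ExponentialMoments

variable {S W V : Type*} [MeasurableSpace S] {P : Measure S}
  [NormedAddCommGroup W] [NormedAddCommGroup V] {μ : S → W}

theorem memLp_exp_mul_norm (hμm : AEStronglyMeasurable μ P)
    (hexp : ∀ c : ℝ, Integrable (fun s => Real.exp (c * ‖μ s‖)) P) (c : ℝ) :
    MemLp (fun s => Real.exp (c * ‖μ s‖)) 2 P := by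
  rw [memLp_two_iff_integrable_sq]
  · refine (hexp (2 * c)).congr (ae_of_all _ fun s => ?_)
    simp only [sq, ← Real.exp_add]
    ring_nf
  · exact (by fun_prop : Continuous fun x : W =>
      Real.exp (c * ‖x‖)).comp_aestronglyMeasurable hμm

theorem memLp_two_of_exp (hμm : AEStronglyMeasurable μ P)
    (hexp : ∀ c : ℝ, Integrable (fun s => Real.exp (c * ‖μ s‖)) P) : MemLp μ 2 P :=
  (memLp_exp_mul_norm hμm hexp 1).mono' hμm (ae_of_all _ fun s => by
    rw [one_mul]; linarith [Real.add_one_le_exp ‖μ s‖])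

theorem memLp_two_comp_of_localVariation_le_exp [IsFiniteMeasure P] [NormedSpace ℝ W]
    (hμm : AEStronglyMeasurable μ P)
    (hexp : ∀ c : ℝ, Integrable (fun s => Real.exp (c * ‖μ s‖)) P) {G : W → V} {A β : ℝ}
    (hA : 0 < A) (hβ : 0 < β)
    (hG : ∀ w, localVariation G w ≤ ENNReal.ofReal (A * Real.exp (β * ‖w‖))) :
    MemLp (fun s => G (μ s)) 2 P := by
  have hd0 : MemLp (fun _ : S => ‖G 0‖) 2 P := memLp_const _
  have hd1 : MemLp (fun s => A * Real.exp ((β + 1) * ‖μ s‖)) 2 P :=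
    (memLp_exp_mul_norm hμm hexp (β + 1)).const_mul A
  have hd : MemLp (fun s => ‖G 0‖ + A * Real.exp ((β + 1) * ‖μ s‖)) 2 P := hd0.add hd1
  refine hd.mono' ((continuous_of_localVariation_le_exp hG).comp_aestronglyMeasurable hμm)
    (ae_of_all _ fun s => ?_)
  have h1 := norm_sub_le_of_localVariation_le_exp hA hβ hG (x := μ s) (y := 0) le_rfl (by simp)
  rw [sub_zero] at h1
  have h2 : ‖G (μ s)‖ ≤ ‖G 0‖ + ‖G (μ s) - G 0‖ := by
    have := norm_add_le (G 0) (G (μ s) - G 0)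
    rwa [add_sub_cancel] at this
  have h3 : ‖μ s‖ ≤ Real.exp ‖μ s‖ := by linarith [Real.add_one_le_exp ‖μ s‖]
  have h4 : A * Real.exp (β * ‖μ s‖) * ‖μ s‖ ≤ A * Real.exp ((β + 1) * ‖μ s‖) := by
    rw [add_mul, one_mul, Real.exp_add, ← mul_assoc]
    gcongr
  linarith

end ExponentialMoments

/-! ### Truncation of expansions -/

section Truncation

variable {S H : Type*} [MeasurableSpace S] [NormedAddCommGroup H] [InnerProductSpace ℝ H]
  {P : Measure S} {U : S → H} {lam : ℕ → ℝ} {ω : ℕ → S → ℝ} {e : ℕ → H}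

/-- The `i`-th mode of an expansion, or `0` if its eigenvalue vanishes. -/
noncomputable def kklMode (lam : ℕ → ℝ) (e : ℕ → H) (i : ℕ) : H :=
  if lam i = 0 then 0 else e i

/-- The projection onto the first `n` modes of an expansion. -/
noncomputable def kklProj (lam : ℕ → ℝ) (e : ℕ → H) (n : ℕ) (x : H) : H :=
  ∑ i ∈ Finset.range n, inner ℝ (kklMode lam e i) x • kklMode lam e i

/-- The coefficients along the first `n` modes. -/
noncomputable def kklCoeff (lam : ℕ → ℝ) (e : ℕ → H) (n : ℕ) (x : H) : EuclideanSpace ℝ (Fin n) :=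
  WithLp.toLp 2 fun i : Fin n => inner ℝ (kklMode lam e i) x

/-- The combination of the first `n` modes with given coefficients. -/
noncomputable def kklSynth (lam : ℕ → ℝ) (e : ℕ → H) (n : ℕ) :
    EuclideanSpace ℝ (Fin n) →L[ℝ] H :=
  ∑ i : Fin n, (EuclideanSpace.proj (𝕜 := ℝ) i).smulRight (kklMode lam e i)

theorem kklSynth_apply (n : ℕ) (c : EuclideanSpace ℝ (Fin n)) :
    kklSynth lam e n c = ∑ i : Fin n, c i • kklMode lam e i := by
  simp [kklSynth]

theorem kklSynth_kklCoeff (n : ℕ) (x : H) :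
    kklSynth lam e n (kklCoeff lam e n x) = kklProj lam e n x := by
  rw [kklSynth_apply]
  exact Fin.sum_univ_eq_sum_range (fun i => inner ℝ (kklMode lam e i) x • kklMode lam e i) n

theorem continuous_kklCoeff (n : ℕ) : Continuous (kklCoeff lam e n) := by
  unfold kklCoeff
  fun_prop

theorem continuous_kklProj (n : ℕ) : Continuous (kklProj lam e n) := by
  unfold kklProj
  fun_prop

theorem smul_kklMode (a : ℝ) (i : ℕ) :
    (√(lam i) * a) • kklMode lam e i = (√(lam i) * a) • e i := by
  unfold kklMode
  split_ifs with h <;> simp [h]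

namespace IsKKLExpansion

theorem inner_kklMode (h : IsKKLExpansion P U lam ω e) {i j : ℕ} (hij : i ≠ j) :
    inner ℝ (kklMode lam e i) (kklMode lam e j) = 0 := by
  unfold kklMode
  split_ifs with hi hj hj
  · simp
  · simp
  · simp
  · exact h.orthonormal.2 (i := ⟨i, hi⟩) (j := ⟨j, hj⟩) (fun h => hij (congrArg Subtype.val h))

theorem norm_kklMode (h : IsKKLExpansion P U lam ω e) {i : ℕ} (hi : lam i ≠ 0) :
    ‖kklMode lam e i‖ = 1 := by
  rw [kklMode, if_neg hi]
  exact h.orthonormal.1 ⟨i, hi⟩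

theorem norm_kklMode_le (h : IsKKLExpansion P U lam ω e) (i : ℕ) : ‖kklMode lam e i‖ ≤ 1 := by
  by_cases hi : lam i = 0
  · simp [kklMode, hi]
  · exact (h.norm_kklMode hi).le

theorem norm_smul_kklMode_sq (h : IsKKLExpansion P U lam ω e) (a : ℝ) (i : ℕ) :
    ‖(√(lam i) * a) • kklMode lam e i‖ ^ 2 = lam i * a ^ 2 := by
  by_cases hi : lam i = 0
  · simp [hi]
  · rw [norm_smul, h.norm_kklMode hi, mul_one, Real.norm_eq_abs, sq_abs, mul_pow,
      Real.sq_sqrt (h.nonneg i)]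

/-- The squared norm of a combination of the modes is at most that of its coefficients. -/
theorem norm_sum_smul_kklMode_sq_le (h : IsKKLExpansion P U lam ω e) {ι : Type*} {g : ι → ℕ}
    (hg : g.Injective) (s : Finset ι) (c : ι → ℝ) :
    ‖∑ i ∈ s, c i • kklMode lam e (g i)‖ ^ 2 ≤ ∑ i ∈ s, c i ^ 2 := by
  rw [norm_sum_sq_of_orthogonal (f := fun i => c i • kklMode lam e (g i))]
  · refine Finset.sum_le_sum fun i _ => ?_
    rw [norm_smul, mul_pow, Real.norm_eq_abs, sq_abs]
    exact mul_le_of_le_one_right (sq_nonneg _)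
      (pow_le_one₀ (norm_nonneg _) (h.norm_kklMode_le _))
  · intro i j hij
    rw [inner_smul_left, inner_smul_right, h.inner_kklMode (hg.ne hij)]
    simp

/-- Bessel's inequality for the modes. -/
theorem sum_inner_kklMode_sq_le (h : IsKKLExpansion P U lam ω e) (s : Finset ℕ) (x : H) :
    ∑ i ∈ s, inner ℝ (kklMode lam e i) x ^ 2 ≤ ‖x‖ ^ 2 := by
  have h1 := h.norm_sum_smul_kklMode_sq_le Function.injective_id s fun i => inner ℝ (kklMode lam e i) x
  simp only [id] at h1
  have h2 := norm_sub_sq_real x (∑ i ∈ s, inner ℝ (kklMode lam e i) x • kklMode lam e i)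
  have h3 : inner ℝ x (∑ i ∈ s, inner ℝ (kklMode lam e i) x • kklMode lam e i) =
      ∑ i ∈ s, inner ℝ (kklMode lam e i) x ^ 2 := by
    rw [inner_sum]
    refine Finset.sum_congr rfl fun i _ => ?_
    rw [inner_smul_right, real_inner_comm, sq]
  nlinarith [sq_nonneg ‖x - ∑ i ∈ s, inner ℝ (kklMode lam e i) x • kklMode lam e i‖]

theorem norm_kklProj_le (h : IsKKLExpansion P U lam ω e) (n : ℕ) (x : H) :
    ‖kklProj lam e n x‖ ≤ ‖x‖ :=
  le_of_sq_le_sq ((h.norm_sum_smul_kklMode_sq_le Function.injective_id _ _).trans (h.sum_inner_kklMode_sq_le _ x))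
    (norm_nonneg _)

theorem norm_kklCoeff_le (h : IsKKLExpansion P U lam ω e) (n : ℕ) (x : H) :
    ‖kklCoeff lam e n x‖ ≤ ‖x‖ := by
  refine le_of_sq_le_sq ?_ (norm_nonneg _)
  rw [EuclideanSpace.real_norm_sq_eq]
  refine le_trans (le_of_eq ?_) (h.sum_inner_kklMode_sq_le (Finset.range n) x)
  exact Fin.sum_univ_eq_sum_range (fun i => inner ℝ (kklMode lam e i) x ^ 2) n

theorem norm_kklSynth_le (h : IsKKLExpansion P U lam ω e) (n : ℕ) (c : EuclideanSpace ℝ (Fin n)) :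
    ‖kklSynth lam e n c‖ ≤ ‖c‖ := by
  refine le_of_sq_le_sq ?_ (norm_nonneg _)
  rw [EuclideanSpace.real_norm_sq_eq, kklSynth_apply]
  exact h.norm_sum_smul_kklMode_sq_le Fin.val_injective _ _

/-- The squared truncation error of a series in the modes. -/
theorem hasSum_norm_sub_kklProj_sq (h : IsKKLExpansion P U lam ω e) {a : ℕ → ℝ} {x : H}
    (hx : HasSum (fun i => (√(lam i) * a i) • e i) x) (n : ℕ) :
    HasSum (fun i => lam (i + n) * a (i + n) ^ 2) (‖x - kklProj lam e n x‖ ^ 2) := by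
  replace hx : HasSum (fun i => (√(lam i) * a i) • kklMode lam e i) x := by
    simpa only [smul_kklMode] using hx
  -- Orthogonality identifies the terms of the series with the projections of its sum onto the
  -- modes.
  have hc : ∀ i, inner ℝ (kklMode lam e i) x • kklMode lam e i =
      (√(lam i) * a i) • kklMode lam e i := by
    intro i
    by_cases hi : lam i = 0
    · simp [kklMode, hi]
    have h1 := hx.mapL (innerSL ℝ (kklMode lam e i))
    simp only [innerSL_apply_apply, inner_smul_right] at h1
    have h2 := h1.unique (hasSum_single i fun j hj => by rw [h.inner_kklMode hj.symm, mul_zero])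
    rw [h2, real_inner_self_eq_norm_sq, h.norm_kklMode hi]
    simp
  have h1 : HasSum (fun i => (√(lam (i + n)) * a (i + n)) • kklMode lam e (i + n))
      (x - kklProj lam e n x) := by
    rw [kklProj, Finset.sum_congr rfl fun i _ => hc i]
    exact (hasSum_nat_add_iff' n).2 hx
  have h2 := HasSum.norm_sq_of_orthogonal (fun i j hij => by
    rw [inner_smul_left, inner_smul_right, h.inner_kklMode (by omega)]; simp) h1
  simpa only [h.norm_smul_kklMode_sq] using h2

theorem summable_tail (h : IsKKLExpansion P U lam ω e) (n : ℕ) : Summable fun i => lam (i + n) :=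
  (summable_nat_add_iff n).2 h.summable

/-- With indices from `0`, the tail after `n` modes starts at `λₙ`. So `√λₙ`, the truncation error
on the ellipsoid, is controlled by the root of the same tail. -/
theorem le_tsum_tail (h : IsKKLExpansion P U lam ω e) (n : ℕ) : lam n ≤ ∑' i, lam (i + n) := by
  simpa using (h.summable_tail n).le_tsum 0 fun i _ => h.nonneg _

/-- The mean squared truncation error is the sum of the remaining eigenvalues. -/
theorem lintegral_norm_sub_kklProj_sq (h : IsKKLExpansion P U lam ω e) (n : ℕ) :
    ∫⁻ s, ‖U s - kklProj lam e n (U s)‖ₑ ^ 2 ∂P = ENNReal.ofReal (∑' i, lam (i + n)) := by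
  have hmeas : ∀ i, AEMeasurable (fun s => ENNReal.ofReal (lam i * ω i s ^ 2)) P := by
    intro i
    by_cases hi : lam i = 0
    · simp [hi]
    · exact (((h.memLp i hi).1.aemeasurable.pow_const 2).const_mul _).ennreal_ofReal
  have hint : ∀ i, ∫⁻ s, ENNReal.ofReal (lam i * ω i s ^ 2) ∂P = ENNReal.ofReal (lam i) := by
    intro i
    by_cases hi : lam i = 0
    · simp [hi]
    · have h1 := h.uncorrelated i i hi hi
      simp only [← sq, if_true] at h1
      rw [← ofReal_integral_eq_lintegral_ofReal, integral_const_mul, h1, mul_one]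
      · exact ((memLp_two_iff_integrable_sq (h.memLp i hi).1).1 (h.memLp i hi)).const_mul _
      · exact ae_of_all _ fun s => mul_nonneg (h.nonneg i) (sq_nonneg _)
  have hpt : ∀ᵐ s ∂P, ‖U s - kklProj lam e n (U s)‖ₑ ^ 2 =
      ∑' i, ENNReal.ofReal (lam (i + n) * ω (i + n) s ^ 2) := by
    filter_upwards [h.expansion] with s hs
    have h1 := h.hasSum_norm_sub_kklProj_sq hs n
    rw [← ofReal_norm, ← ENNReal.ofReal_pow (norm_nonneg _), ← h1.tsum_eq,
      ENNReal.ofReal_tsum_of_nonneg (fun i => mul_nonneg (h.nonneg _) (sq_nonneg _)) h1.summable]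
  rw [lintegral_congr_ae hpt, lintegral_tsum fun i => hmeas (i + n),
    ENNReal.ofReal_tsum_of_nonneg (fun i => h.nonneg _) (h.summable_tail n)]
  exact tsum_congr fun i => hint (i + n)

/-- Truncation at `n = 0` gives `∑ λᵢ = 𝔼‖U‖²`, a bound that does not depend on the expansion. -/
theorem lam_zero_le (h : IsKKLExpansion P U lam ω e) (hU : MemLp U 2 P) :
    lam 0 ≤ ∫ s, ‖U s‖ ^ 2 ∂P := by
  have h1 := h.lintegral_norm_sub_kklProj_sq 0
  simp only [kklProj, Finset.range_zero, Finset.sum_empty, sub_zero, add_zero] at h1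
  have h2 : ∑' i, lam i = ∫ s, ‖U s‖ ^ 2 ∂P := by
    rw [integral_eq_lintegral_of_nonneg_ae (ae_of_all _ fun s => sq_nonneg _)
      (hU.1.norm.pow 2)]
    simp only [ENNReal.ofReal_pow (norm_nonneg _), ofReal_norm]
    rw [h1, ENNReal.toReal_ofReal (tsum_nonneg h.nonneg)]
  rw [← h2]
  simpa using h.le_tsum_tail 0

/-- A weighted mean truncation error, by the Cauchy-Schwarz inequality. -/
theorem lintegral_mul_norm_sub_kklProj_le (h : IsKKLExpansion P U lam ω e)
    (hU : AEStronglyMeasurable U P) {F : S → ℝ} (hF : MemLp F 2 P) (n : ℕ) :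
    ∫⁻ s, ‖F s‖ₑ * ‖U s - kklProj lam e n (U s)‖ₑ ∂P ≤
      ENNReal.ofReal (√(∫ s, F s ^ 2 ∂P) * √(∑' i, lam (i + n))) := by
  have hU' : AEStronglyMeasurable (fun s => U s - kklProj lam e n (U s)) P :=
    hU.sub ((continuous_kklProj n).comp_aestronglyMeasurable hU)
  have h1 := ENNReal.lintegral_mul_le_Lp_mul_Lq P Real.HolderConjugate.two_two
    hF.1.enorm hU'.enorm
  refine h1.trans_eq ?_
  have h2 : ∫⁻ s, ‖F s‖ₑ ^ 2 ∂P = ENNReal.ofReal (∫ s, F s ^ 2 ∂P) := by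
    rw [ofReal_integral_eq_lintegral_ofReal ((memLp_two_iff_integrable_sq hF.1).1 hF)
      (ae_of_all _ fun s => sq_nonneg _)]
    refine lintegral_congr fun s => ?_
    rw [← ofReal_norm, ← ENNReal.ofReal_pow (norm_nonneg _), Real.norm_eq_abs, sq_abs]
  simp only [ENNReal.rpow_two]
  rw [h2, h.lintegral_norm_sub_kklProj_sq, ENNReal.ofReal_mul (Real.sqrt_nonneg _),
    ENNReal.ofReal_rpow_of_nonneg (integral_nonneg fun s => sq_nonneg _) (by norm_num),
    ENNReal.ofReal_rpow_of_nonneg (tsum_nonneg fun i => h.nonneg _) (by norm_num),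
    Real.sqrt_eq_rpow, Real.sqrt_eq_rpow]

/-- Truncation error in the ellipsoid of an expansion. -/
theorem norm_sub_kklProj_le_of_mem_kklEllipsoid (h : IsKKLExpansion P U lam ω e) {m w : H}
    (hw : w ∈ kklEllipsoid m lam e) (n : ℕ) :
    ‖(w - m) - kklProj lam e n (w - m)‖ ≤ √(lam n) := by
  obtain ⟨ν, hν, hν1, hsum⟩ := hw
  refine Real.le_sqrt_of_sq_le ?_
  have h1 := h.hasSum_norm_sub_kklProj_sq hsum n
  have hν' : Summable fun i => ν (i + n) ^ 2 :=
    (summable_nat_add_iff (f := fun i => ν i ^ 2) n).2 hν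
  have h2 : ∑' i, ν (i + n) ^ 2 ≤ 1 := by
    have := hν.sum_add_tsum_nat_add n
    have h3 : 0 ≤ ∑ i ∈ Finset.range n, ν i ^ 2 := Finset.sum_nonneg fun i _ => sq_nonneg _
    linarith
  rw [← h1.tsum_eq]
  calc ∑' i, lam (i + n) * ν (i + n) ^ 2 ≤ ∑' i, lam n * ν (i + n) ^ 2 :=
        h1.summable.tsum_le_tsum (fun i => mul_le_mul_of_nonneg_right
          (h.antitone (Nat.le_add_left n i)) (sq_nonneg _)) (hν'.mul_left _)
    _ = lam n * ∑' i, ν (i + n) ^ 2 := tsum_mul_left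
    _ ≤ lam n := mul_le_of_le_one_right (h.nonneg n) h2

theorem norm_sub_le_of_mem_kklEllipsoid (h : IsKKLExpansion P U lam ω e) {m w : H}
    (hw : w ∈ kklEllipsoid m lam e) : ‖w - m‖ ≤ √(lam 0) := by
  simpa [kklProj] using h.norm_sub_kklProj_le_of_mem_kklEllipsoid hw 0

end IsKKLExpansion

end Truncation

/-! ### Bound by the output eigenvalues -/

section OutputBound

variable {S V : Type*} [MeasurableSpace S] {P : Measure S} [IsProbabilityMeasure P]
  [NormedAddCommGroup V] [InnerProductSpace ℝ V] [MeasurableSpace V] [BorelSpace V]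
  {u : S → V} {lam : ℕ → ℝ} {ω : ℕ → S → ℝ} {v : ℕ → V}

/-- Principal component analysis of the output: the encoder takes the leading coefficients of its
argument, rescaled so as to be bounded by `1` on the control set. -/
theorem IsKKLExpansion.optimalError_le (h : IsKKLExpansion P u lam ω v) (hu : MemLp u 2 P)
    {B : Set V} {R M L : ℝ} (hR : 0 < R) (hB : ∀ b ∈ B, ‖b‖ ≤ R) (hM : 1 ≤ M) (hL : R ≤ L)
    (n : ℕ) : optimalError P u B M L n ≤ ENNReal.ofReal √(∑' i, lam (i + n)) := by
  have hnorm : ∀ x : V, ‖R⁻¹ • kklCoeff lam v n x‖ ≤ R⁻¹ * ‖x‖ := fun x => by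
    rw [norm_smul, Real.norm_of_nonneg (inv_nonneg.2 hR.le)]
    exact mul_le_mul_of_nonneg_left (h.norm_kklCoeff_le n x) (inv_nonneg.2 hR.le)
  refine iInf₂_le_of_le (fun x => R⁻¹ • kklCoeff lam v n x) ⟨?_, ?_, fun b hb => ?_⟩
    (iInf₂_le_of_le (fun c => R • kklSynth lam v n c) ⟨?_, fun c _ => ?_⟩ ?_)
  · exact ((continuous_kklCoeff (lam := lam) (e := v) n).const_smul R⁻¹).measurable
  · exact HasFiniteIntegral.mono ((hu.integrable one_le_two).norm.const_mul R⁻¹).2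
      (ae_of_all _ fun s => (hnorm (u s)).trans (le_abs_self _))
  · calc _ ≤ R⁻¹ * ‖b‖ := hnorm b
      _ ≤ R⁻¹ * R := mul_le_mul_of_nonneg_left (hB b hb) (inv_nonneg.2 hR.le)
      _ = 1 := inv_mul_cancel₀ hR.ne'
      _ ≤ M := hM
  · exact ((kklSynth lam v n).continuous.const_smul R).measurable
  · refine localVariation_le_of_lipschitz (hR.le.trans hL) (fun x y => ?_) c
    rw [← smul_sub, ← map_sub, norm_smul, Real.norm_of_nonneg hR.le]
    exact mul_le_mul hL (h.norm_kklSynth_le n _) (norm_nonneg _) (hR.le.trans hL)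
  · have h1 := h.lintegral_mul_norm_sub_kklProj_le hu.1 (memLp_const (1 : ℝ)) n
    simp only [enorm_one, one_mul, one_pow, integral_const, probReal_univ, smul_eq_mul,
      mul_one, Real.sqrt_one] at h1
    simpa only [map_smul, smul_smul, mul_inv_cancel₀ hR.ne', one_smul, kklSynth_kklCoeff] using h1

end OutputBound

/-! ### Measurable selection -/

section Selection

/-- Measurable selection of a near-minimizer of a penalized reconstruction error. -/
theorem exists_measurable_near_minimizer {E V : Type*} [NormedAddCommGroup E]
    [SecondCountableTopology E] [MeasurableSpace E] [NormedAddCommGroup V] [MeasurableSpace V]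
    [BorelSpace V] {Ψ : E → V} (hΨ : Continuous Ψ) {C : Set E} (hC : C.Nonempty) {δ ε : ℝ}
    (hδ : 0 ≤ δ) (hε : 0 < ε) :
    ∃ s : V → E, Measurable s ∧ (∀ v, s v ∈ C) ∧
      ∀ v, ∀ c ∈ C, ‖v - Ψ (s v)‖ + δ * ‖s v‖ ≤ ‖v - Ψ c‖ + δ * ‖c‖ + ε := by
  classical
  have : Nonempty C := hC.to_subtype
  -- By continuity the infimum over `C` is the infimum over a dense sequence, and taking the first
  -- index within `ε` of it is a measurable choice.
  set d : ℕ → C := TopologicalSpace.denseSeq C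
  set g : ℕ → V → ℝ := fun k v => ‖v - Ψ (d k)‖ + δ * ‖(d k : E)‖
  have hg0 : ∀ k v, 0 ≤ g k v := fun k v => by positivity
  have hbdd : ∀ v, BddBelow (Set.range fun k => g k v) := fun v =>
    ⟨0, by rintro _ ⟨k, rfl⟩; exact hg0 k v⟩
  have hgm : ∀ k, Measurable (g k) := fun k =>
    (by fun_prop : Continuous fun v : V => ‖v - Ψ (d k)‖ + δ * ‖(d k : E)‖).measurable
  have hex : ∀ v, ∃ k, g k v < (⨅ k, g k v) + ε := fun v =>
    exists_lt_of_ciInf_lt (lt_add_of_pos_right _ hε)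
  refine ⟨fun v => d (Nat.find (hex v)), ?_, fun v => (d _).2, fun v c hc => ?_⟩
  · exact Measurable.find (f := fun k _ => (d k : E)) (fun _ => measurable_const)
      (fun k => measurableSet_lt (hgm k) ((Measurable.iInf hgm).add_const ε)) hex
  · have h1 : (⨅ k, g k v) ≤ ‖v - Ψ c‖ + δ * ‖c‖ := by
      have hcl : IsClosed {x : C | (⨅ k, g k v) ≤ ‖v - Ψ x‖ + δ * ‖(x : E)‖} :=
        isClosed_le continuous_const (by fun_prop)
      exact (TopologicalSpace.denseRange_denseSeq C).induction_on
        (p := fun x : C => (⨅ k, g k v) ≤ ‖v - Ψ x‖ + δ * ‖(x : E)‖) ⟨c, hc⟩ hcl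
        fun k => ciInf_le (hbdd v) k
    have h2 := Nat.find_spec (hex v)
    simp only [g] at h1 h2 ⊢
    linarith

end Selection

/-! ### Radial reparametrization -/

section Reparametrization

variable {E : Type*} [NormedAddCommGroup E] [InnerProductSpace ℝ E]

/-- The right side minus the left is `(p - q) (p ‖x‖² - q ‖y‖²)`. -/
theorem mul_norm_sub_sq_le_norm_smul_sub_smul_sq {x y : E} {p q : ℝ} (hq : 0 ≤ q) (hpq : q ≤ p)
    (hxy : ‖y‖ ≤ ‖x‖) : p * q * ‖x - y‖ ^ 2 ≤ ‖p • x - q • y‖ ^ 2 := by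
  rw [norm_sub_sq_real, norm_sub_sq_real, norm_smul, norm_smul, inner_smul_left,
    inner_smul_right, Real.norm_of_nonneg hq, Real.norm_of_nonneg (hq.trans hpq)]
  have hp := hq.trans hpq
  have h1 : q * ‖y‖ ^ 2 ≤ p * ‖x‖ ^ 2 := by gcongr
  have h2 := mul_nonneg (sub_nonneg.2 hpq) (sub_nonneg.2 h1)
  simp only [conj_trivial]
  nlinarith

/-- The radial map `x ↦ exp (2 b (‖x‖ - 1)) x`. -/
noncomputable def radialExp (b : ℝ) (x : E) : E := Real.exp (2 * b * (‖x‖ - 1)) • x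

theorem continuous_radialExp (b : ℝ) : Continuous (radialExp b : E → E) := by
  unfold radialExp
  fun_prop

theorem norm_radialExp (b : ℝ) (x : E) :
    ‖radialExp b x‖ = Real.exp (2 * b * (‖x‖ - 1)) * ‖x‖ := by
  rw [radialExp, norm_smul, Real.norm_of_nonneg (Real.exp_pos _).le]

/-- The shift by `1` in the exponent serves this bound: codes of the control set stay below `1 ≤ M`,
and the cost is a factor `exp (2 * b)` in the Lipschitz constant. -/
theorem norm_radialExp_le {b : ℝ} (hb : 0 ≤ b) {x : E} (hx : ‖x‖ ≤ 1) : ‖radialExp b x‖ ≤ 1 := by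
  rw [norm_radialExp]
  refine mul_le_one₀ (Real.exp_le_one_iff.2 ?_) (norm_nonneg _) hx
  exact mul_nonpos_of_nonneg_of_nonpos (by positivity) (by linarith)

/-- The radial map expands distances exponentially. -/
theorem exp_mul_norm_sub_le_norm_radialExp_sub {b : ℝ} (hb : 0 ≤ b) (x y : E) :
    Real.exp (b * max ‖x‖ ‖y‖) * ‖x - y‖ ≤
      Real.exp (2 * b) * ‖radialExp b x - radialExp b y‖ := by
  wlog hxy : ‖y‖ ≤ ‖x‖ generalizing x y
  · rw [max_comm, norm_sub_rev x, norm_sub_rev (radialExp b x)]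
    exact this y x (not_le.1 hxy).le
  rw [max_eq_left hxy]
  refine le_of_sq_le_sq ?_ (by positivity)
  -- Distances grow at least by the geometric mean `exp (b (‖x‖ + ‖y‖ - 2))` of the two radial
  -- factors, hence the `2 * b` in their exponents.
  have h1 := mul_norm_sub_sq_le_norm_smul_sub_smul_sq (Real.exp_pos (2 * b * (‖y‖ - 1))).le
    (Real.exp_le_exp.2 (by gcongr) :
      Real.exp (2 * b * (‖y‖ - 1)) ≤ Real.exp (2 * b * (‖x‖ - 1))) hxy
  rw [mul_pow, mul_pow]
  calc Real.exp (b * ‖x‖) ^ 2 * ‖x - y‖ ^ 2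
      ≤ Real.exp (2 * b) ^ 2 * (Real.exp (2 * b * (‖x‖ - 1)) * Real.exp (2 * b * (‖y‖ - 1))) *
        ‖x - y‖ ^ 2 := by
        gcongr
        rw [sq, sq, ← Real.exp_add, ← Real.exp_add, ← Real.exp_add, ← Real.exp_add]
        refine Real.exp_le_exp.2 ?_
        have := mul_nonneg hb (norm_nonneg y)
        nlinarith
    _ ≤ Real.exp (2 * b) ^ 2 * ‖radialExp b x - radialExp b y‖ ^ 2 := by
        rw [mul_assoc]
        gcongr
        exact h1

theorem surjective_radialExp {b : ℝ} (hb : 0 ≤ b) :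
    Function.Surjective (radialExp b : E → E) := by
  intro y
  by_cases hy : y = 0
  · exact ⟨0, by simp [radialExp, hy]⟩
  have hy0 : 0 < ‖y‖ := norm_pos_iff.2 hy
  -- At `r = exp (2 * b) * ‖y‖` the radial profile equals `exp (2 * b * r) * ‖y‖ ≥ ‖y‖`.
  obtain ⟨r, ⟨hr0, -⟩, hr⟩ := intermediate_value_Icc
    (a := 0) (b := Real.exp (2 * b) * ‖y‖) (by positivity)
    (f := fun r => Real.exp (2 * b * (r - 1)) * r) (by fun_prop)
    (show ‖y‖ ∈ Set.Icc _ _ from ⟨by simp, by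
      rw [← mul_assoc, ← Real.exp_add]
      refine le_mul_of_one_le_left hy0.le (Real.one_le_exp ?_)
      have : 0 ≤ 2 * b * (Real.exp (2 * b) * ‖y‖) := by positivity
      linarith⟩)
  have hn : ‖(r / ‖y‖) • y‖ = r := by
    rw [norm_smul, Real.norm_of_nonneg (by positivity), div_mul_cancel₀ _ hy0.ne']
  refine ⟨(r / ‖y‖) • y, ?_⟩
  rw [radialExp, hn, smul_smul, ← mul_div_assoc]
  simp only at hr
  rw [hr, div_self hy0.ne', one_smul]

/-- A map with exponentially bounded Lipschitz constants becomes globally Lipschitz after a radial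
change of variables. -/
theorem exists_lipschitz_reparametrization {V : Type*} [NormedAddCommGroup V] {Ψ₀ : E → V}
    {a b : ℝ} (ha : 0 ≤ a) (hb : 0 ≤ b)
    (h : ∀ x y, ‖Ψ₀ x - Ψ₀ y‖ ≤ a * Real.exp (b * max ‖x‖ ‖y‖) * ‖x - y‖) :
    ∃ Ψ : E → V, (∀ x, Ψ (radialExp b x) = Ψ₀ x) ∧
      ∀ c c', ‖Ψ c - Ψ c'‖ ≤ a * Real.exp (2 * b) * ‖c - c'‖ := by
  have key : ∀ x y, ‖Ψ₀ x - Ψ₀ y‖ ≤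
      a * Real.exp (2 * b) * ‖radialExp b x - radialExp b y‖ := by
    intro x y
    refine (h x y).trans ?_
    rw [mul_assoc, mul_assoc]
    exact mul_le_mul_of_nonneg_left (exp_mul_norm_sub_le_norm_radialExp_sub hb x y) ha
  obtain ⟨g, hg⟩ := (surjective_radialExp (E := E) hb).hasRightInverse
  -- By `key`, `Ψ₀` takes equal values at points with the same radial image, so the choice of the
  -- right inverse is immaterial.
  refine ⟨Ψ₀ ∘ g, fun x => ?_, fun c c' => ?_⟩
  · have := key (g (radialExp b x)) x
    rw [hg, sub_self, norm_zero, mul_zero] at this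
    exact sub_eq_zero.1 (norm_le_zero_iff.1 this)
  · have := key (g c) (g c')
    rwa [hg, hg] at this

end Reparametrization

/-! ### Bound by the input eigenvalues -/

section InputBound

variable {S W V : Type*} [MeasurableSpace S] {P : Measure S} [IsProbabilityMeasure P]
  [NormedAddCommGroup W] [InnerProductSpace ℝ W]
  [NormedAddCommGroup V] [MeasurableSpace V] [BorelSpace V]
  {μ : S → W} {m : W} {G : W → V} {A β σ : ℝ} {lam : ℕ → ℝ} {η : ℕ → S → ℝ} {φ : ℕ → W}

/-- The encoder-decoder pair built on a Lipschitz reparametrization `Ψ` of the operator restricted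
to the leading modes of the input: the encoder nearly minimizes the penalized reconstruction error,
within the unit ball near the control set and globally elsewhere. -/
theorem optimalError_le_of_lipschitz_decoder {u : S → V} {B : Set V} {n : ℕ}
    {Ψ : EuclideanSpace ℝ (Fin n) → V} {M L κ ρ : ℝ} (hL : 0 ≤ L) (hM : 1 ≤ M)
    (hΨ : ∀ c c', ‖Ψ c - Ψ c'‖ ≤ L * ‖c - c'‖)
    (hB : ∀ v ∈ B, ∃ c, ‖c‖ ≤ 1 ∧ ‖v - Ψ c‖ ≤ κ)
    {q : S → EuclideanSpace ℝ (Fin n)} (hq : Integrable q P) {g : S → ℝ≥0∞}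
    (hg : ∫⁻ s, g s ∂P ≤ ENNReal.ofReal ρ) (hqg : ∀ s, ‖u s - Ψ (q s)‖ₑ ≤ g s)
    (hκ : 0 ≤ κ) (hρ : 0 ≤ ρ) :
    optimalError P u B M L n ≤ ENNReal.ofReal (κ + ρ) := by
  have hΨc : Continuous Ψ :=
    (LipschitzWith.of_dist_le_mul (K := L.toNNReal) fun x y => by
      rw [dist_eq_norm, dist_eq_norm, Real.coe_toNNReal _ hL]; exact hΨ x y).continuous
  refine ENNReal.le_of_forall_pos_le_add fun ε' hε' _ => ?_
  set J := ∫ s, ‖q s‖ ∂P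
  have hJ : 0 ≤ J := integral_nonneg fun s => norm_nonneg _
  -- One half of `ε'` pays for the near-minimization, the other for the penalty, whose mean `δ * J`
  -- is at most `ε`.
  set ε : ℝ := ε' / 2
  have hε : 0 < ε := by positivity
  set δ : ℝ := ε / (J + 1)
  have hδ : 0 < δ := by positivity
  have hδJ : δ * J ≤ ε := by
    rw [div_mul_eq_mul_div, div_le_iff₀ (by positivity)]
    nlinarith
  have hJq : ∫⁻ s, ‖q s‖ₑ ∂P = ENNReal.ofReal J := by
    rw [ofReal_integral_norm_eq_lintegral_enorm hq]
  obtain ⟨s₁, hs₁m, hs₁C, hs₁⟩ := exists_measurable_near_minimizer (V := V) hΨc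
    (C := Metric.closedBall 0 1) (Metric.nonempty_closedBall.2 zero_le_one) le_rfl hε
  obtain ⟨s₂, hs₂m, -, hs₂⟩ := exists_measurable_near_minimizer (V := V) hΨc
    Set.univ_nonempty hδ.le hε
  simp only [zero_mul, add_zero] at hs₁
  set I : Set V := Ψ '' Metric.closedBall 0 1
  have hI : I.Nonempty := (Metric.nonempty_closedBall.2 zero_le_one).image Ψ
  -- A closed, hence measurable, set that contains `B`; on it some code in the unit ball attains an
  -- error arbitrarily close to `κ`.
  set D : Set V := {v | Metric.infDist v I ≤ κ}
  have hD : MeasurableSet D :=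
    (isClosed_le (Metric.continuous_infDist_pt I) continuous_const).measurableSet
  have hBD : B ⊆ D := fun v hv => by
    obtain ⟨c, hc, hvc⟩ := hB v hv
    refine (Metric.infDist_le_dist_of_mem
      (Set.mem_image_of_mem Ψ (mem_closedBall_zero_iff.2 hc))).trans ?_
    rwa [dist_eq_norm]
  classical
  set E : V → EuclideanSpace ℝ (Fin n) := D.piecewise s₁ s₂
  have hE1 : ∀ v ∈ D, ‖E v‖ ≤ 1 := fun v hv => by
    simp only [E, Set.piecewise_eq_of_mem _ _ _ hv]
    exact mem_closedBall_zero_iff.1 (hs₁C v)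
  have hED : ∀ v ∈ D, ‖v - Ψ (E v)‖ ≤ κ + ε := fun v hv => by
    simp only [E, Set.piecewise_eq_of_mem _ _ _ hv]
    have h1 : ‖v - Ψ (s₁ v)‖ - ε ≤ Metric.infDist v I := by
      refine (Metric.le_infDist hI).2 ?_
      rintro _ ⟨c, hc, rfl⟩
      rw [dist_eq_norm]
      linarith [hs₁ v c hc]
    have h2 : Metric.infDist v I ≤ κ := hv
    linarith
  have hE2 : ∀ v ∉ D, ∀ c, ‖v - Ψ (E v)‖ + δ * ‖E v‖ ≤ ‖v - Ψ c‖ + δ * ‖c‖ + ε :=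
    fun v hv c => by
      simp only [E, Set.piecewise_eq_of_notMem _ _ _ hv]
      exact hs₂ v c trivial
  -- Off `D` the competitor is `q s`, which may use the hidden input; near-minimality over all codes
  -- beats it up to `ε` and the penalty.
  have herr : ∀ s, ‖u s - Ψ (E (u s))‖ₑ ≤
      ENNReal.ofReal (κ + ε) + (g s + ENNReal.ofReal δ * ‖q s‖ₑ) := by
    intro s
    have h1 : ‖u s - Ψ (E (u s))‖ ≤ (κ + ε) + (‖u s - Ψ (q s)‖ + δ * ‖q s‖) := by
      by_cases hs : u s ∈ D
      · have := hED _ hs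
        have : 0 ≤ ‖u s - Ψ (q s)‖ + δ * ‖q s‖ := by positivity
        linarith
      · have := hE2 _ hs (q s)
        have : 0 ≤ δ * ‖E (u s)‖ := by positivity
        linarith
    rw [← ofReal_norm]
    refine (ENNReal.ofReal_le_ofReal h1).trans ?_
    rw [ENNReal.ofReal_add (p := κ + ε) (by positivity) (by positivity),
      ENNReal.ofReal_add (p := ‖u s - Ψ (q s)‖) (by positivity) (by positivity),
      ENNReal.ofReal_mul hδ.le,
      ofReal_norm, ofReal_norm]
    gcongr
    exact hqg s
  -- Off `D` the penalty term alone is at most the competitor's penalized error plus `ε`; dividing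
  -- by `δ` bounds the code.
  have hcode : ∀ s, ‖E (u s)‖ₑ ≤
      ENNReal.ofReal (1 + ε / δ) + (ENNReal.ofReal δ⁻¹ * g s + ‖q s‖ₑ) := by
    intro s
    have h1 : ‖E (u s)‖ ≤ (1 + ε / δ) + (δ⁻¹ * ‖u s - Ψ (q s)‖ + ‖q s‖) := by
      by_cases hs : u s ∈ D
      · have := hE1 _ hs
        have : 0 ≤ ε / δ + (δ⁻¹ * ‖u s - Ψ (q s)‖ + ‖q s‖) := by positivity
        linarith
      · have h2 := hE2 _ hs (q s)
        have h3 : δ * ‖E (u s)‖ ≤ ‖u s - Ψ (q s)‖ + δ * ‖q s‖ + ε := by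
          linarith [norm_nonneg (u s - Ψ (E (u s)))]
        rw [← le_div_iff₀' hδ] at h3
        refine h3.trans ?_
        rw [add_div, add_div, mul_div_cancel_left₀ _ hδ.ne', div_eq_inv_mul _ δ]
        linarith
    rw [← ofReal_norm]
    refine (ENNReal.ofReal_le_ofReal h1).trans ?_
    rw [ENNReal.ofReal_add (p := 1 + ε / δ) (by positivity) (by positivity),
      ENNReal.ofReal_add (q := ‖q s‖) (by positivity) (by positivity),
      ENNReal.ofReal_mul (inv_nonneg.2 hδ.le), ofReal_norm, ofReal_norm]
    gcongr
    exact hqg s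
  have hgfin : ∫⁻ s, g s ∂P < ∞ := hg.trans_lt ENNReal.ofReal_lt_top
  refine iInf₂_le_of_le E ⟨hs₁m.piecewise hD hs₂m, ?_, fun v hv => (hE1 v (hBD hv)).trans hM⟩
    (iInf₂_le_of_le Ψ ⟨hΨc.measurable, fun c _ => localVariation_le_of_lipschitz hL hΨ c⟩ ?_)
  · refine (lintegral_mono hcode).trans_lt ?_
    rw [lintegral_add_left measurable_const, lintegral_add_right' _ hq.1.enorm,
      lintegral_const_mul' _ _ ENNReal.ofReal_ne_top, lintegral_const, hJq]
    simp only [measure_univ, mul_one]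
    exact ENNReal.add_lt_top.2 ⟨ENNReal.ofReal_lt_top, ENNReal.add_lt_top.2
      ⟨ENNReal.mul_lt_top ENNReal.ofReal_lt_top hgfin, ENNReal.ofReal_lt_top⟩⟩
  · refine (lintegral_mono herr).trans ?_
    rw [lintegral_add_left measurable_const, lintegral_add_right' _ (hq.1.enorm.const_mul _),
      lintegral_const_mul' _ _ ENNReal.ofReal_ne_top, lintegral_const, hJq]
    simp only [measure_univ, mul_one]
    calc ENNReal.ofReal (κ + ε) + (∫⁻ s, g s ∂P + ENNReal.ofReal δ * ENNReal.ofReal J)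
        ≤ ENNReal.ofReal (κ + ε) + (ENNReal.ofReal ρ + ENNReal.ofReal ε) := by
          rw [← ENNReal.ofReal_mul hδ.le]
          gcongr
      _ = ENNReal.ofReal (κ + ρ) + ε' := by
          rw [← ENNReal.ofReal_coe_nnreal, ← ENNReal.ofReal_add hρ hε.le,
            ← ENNReal.ofReal_add (by positivity) (by positivity),
            ← ENNReal.ofReal_add (by positivity) (by positivity)]
          congr 1
          simp only [ε]
          ring

/-- Bound by the truncation error of the input. -/
theorem IsKKLExpansion.optimalError_comp_le
    (h : IsKKLExpansion P (fun s => μ s - m) lam η φ) (hμm : AEStronglyMeasurable μ P)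
    (hexp : ∀ c : ℝ, Integrable (fun s => Real.exp (c * ‖μ s‖)) P) (hA : 0 < A) (hβ : 0 < β)
    (hG : ∀ w, localVariation G w ≤ ENNReal.ofReal (A * Real.exp (β * ‖w‖)))
    (hσ : 0 < σ) (hlam : √(lam 0) ≤ σ) {M L : ℝ} (hM : 1 ≤ M)
    (hL : A * Real.exp (β * ‖m‖) * σ * Real.exp (2 * (β * σ)) ≤ L) (n : ℕ) :
    optimalError P (fun s => G (μ s)) (G '' kklEllipsoid m lam φ) M L n ≤
      ENNReal.ofReal ((A * Real.exp (β * (‖m‖ + σ)) +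
        √(∫ s, (A * Real.exp (β * (2 * ‖m‖ + ‖μ s‖))) ^ 2 ∂P)) * √(∑' i, lam (i + n))) := by
  set K := kklSynth lam φ n
  set Q := kklCoeff lam φ n
  set Ψ₀ : EuclideanSpace ℝ (Fin n) → V := fun c => G (m + σ • K c)
  have hKn : ∀ c, ‖m + σ • K c‖ ≤ ‖m‖ + σ * ‖c‖ := fun c => by
    refine (norm_add_le _ _).trans ?_
    rw [norm_smul, Real.norm_of_nonneg hσ.le]
    gcongr
    exact h.norm_kklSynth_le n c
  -- The scaling by `σ` lets unit codes cover the ellipsoid; in the Lipschitz constant of `Ψ₀` it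
  -- contributes the factor `σ` and turns the rate `β` into `β * σ`.
  obtain ⟨Ψ, hΨ, hΨL⟩ := exists_lipschitz_reparametrization (Ψ₀ := Ψ₀)
    (a := A * Real.exp (β * ‖m‖) * σ) (b := β * σ) (by positivity) (by positivity)
    (fun x y => by
      have h1 := norm_sub_le_of_localVariation_le_exp hA hβ hG
        (R := ‖m‖ + σ * max ‖x‖ ‖y‖)
        ((hKn x).trans (by gcongr; exact le_max_left _ _))
        ((hKn y).trans (by gcongr; exact le_max_right _ _))
      refine h1.trans ?_
      rw [add_sub_add_left_eq_sub, ← smul_sub, ← map_sub, norm_smul, Real.norm_of_nonneg hσ.le,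
        mul_add, Real.exp_add, ← mul_assoc β σ]
      calc _ ≤ A * (Real.exp (β * ‖m‖) * Real.exp (β * σ * max ‖x‖ ‖y‖)) * (σ * ‖x - y‖) := by
            gcongr
            exact h.norm_kklSynth_le n _
        _ = _ := by ring)
  set code : W → EuclideanSpace ℝ (Fin n) := fun w => radialExp (β * σ) (σ⁻¹ • Q (w - m))
  have hcode : ∀ w, Ψ (code w) = G (m + kklProj lam φ n (w - m)) := fun w => by
    simp only [code, hΨ, Ψ₀, map_smul, smul_smul, mul_inv_cancel₀ hσ.ne', one_smul, K, Q,
      kklSynth_kklCoeff]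
  have hQn : ∀ w, ‖σ⁻¹ • Q (w - m)‖ ≤ σ⁻¹ * ‖w - m‖ := fun w => by
    rw [norm_smul, Real.norm_of_nonneg (inv_nonneg.2 hσ.le)]
    exact mul_le_mul_of_nonneg_left (h.norm_kklCoeff_le n _) (inv_nonneg.2 hσ.le)
  have hcodec : Continuous code :=
    (continuous_radialExp _).comp
      (((continuous_kklCoeff n).comp (continuous_sub_right m)).const_smul σ⁻¹)
  have hproj : ∀ w, ‖m + kklProj lam φ n (w - m)‖ ≤ ‖m‖ + ‖w - m‖ := fun w =>
    (norm_add_le _ _).trans (by gcongr; exact h.norm_kklProj_le n _)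
  have hw : ∀ w, ‖w‖ ≤ ‖m‖ + ‖w - m‖ := fun w => by
    simpa using norm_add_le m (w - m)
  have hGw : ∀ w, ‖G w - Ψ (code w)‖ ≤ A * Real.exp (β * (‖m‖ + ‖w - m‖)) *
      ‖(w - m) - kklProj lam φ n (w - m)‖ := fun w => by
    rw [hcode, sub_sub w m]
    exact norm_sub_le_of_localVariation_le_exp hA hβ hG (hw w) (hproj w)
  have hF : MemLp (fun s => A * Real.exp (β * (2 * ‖m‖ + ‖μ s‖))) 2 P := by
    have h1 := (memLp_exp_mul_norm hμm hexp β).const_mul (A * Real.exp (β * (2 * ‖m‖)))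
    refine h1.ae_eq (ae_of_all _ fun s => ?_)
    simp only [mul_add, Real.exp_add]
    ring
  have hμm' : AEStronglyMeasurable (fun s => μ s - m) P := hμm.sub aestronglyMeasurable_const
  have hq : Integrable (fun s => code (μ s)) P := by
    -- The radial map has norm at most `exp ((2 * (β * σ) + 1) * r)`, and `r ≤ σ⁻¹ * (‖m‖ + ‖μ s‖)`.
    set c := (2 * (β * σ) + 1) * σ⁻¹
    refine ((hexp c).const_mul (Real.exp (c * ‖m‖))).mono'
      (hcodec.comp_aestronglyMeasurable hμm) (ae_of_all _ fun s => ?_)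
    have hc : 0 ≤ c := by positivity
    set r := ‖σ⁻¹ • Q (μ s - m)‖
    have hr : (2 * (β * σ) + 1) * r ≤ c * ‖m‖ + c * ‖μ s‖ := by
      have h1 : (2 * (β * σ) + 1) * r ≤ (2 * (β * σ) + 1) * (σ⁻¹ * (‖m‖ + ‖μ s‖)) := by
        gcongr
        refine (hQn _).trans ?_
        gcongr
        rw [add_comm]
        exact norm_sub_le _ _
      refine h1.trans_eq ?_
      simp only [c]
      ring
    rw [← Real.exp_add]
    refine le_trans ?_ (Real.exp_le_exp.2 hr)
    simp only [code]
    rw [norm_radialExp, add_mul, one_mul, Real.exp_add]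
    have hr0 : 0 ≤ r := norm_nonneg _
    have : 0 ≤ β * σ := by positivity
    refine mul_le_mul (Real.exp_le_exp.2 (by nlinarith)) ?_ hr0 (Real.exp_pos _).le
    linarith [Real.add_one_le_exp r]
  have htail : √(lam n) ≤ √(∑' i, lam (i + n)) := Real.sqrt_le_sqrt (h.le_tsum_tail n)
  rw [add_mul]
  refine optimalError_le_of_lipschitz_decoder (Ψ := Ψ) (le_trans (by positivity) hL) hM
    (fun c c' => (hΨL c c').trans (by gcongr)) ?_ hq
    (h.lintegral_mul_norm_sub_kklProj_le hμm' hF n) (fun s => ?_) (by positivity) (by positivity)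
  · rintro _ ⟨w, hwE, rfl⟩
    have hwm : ‖w - m‖ ≤ σ := (h.norm_sub_le_of_mem_kklEllipsoid hwE).trans hlam
    refine ⟨code w, norm_radialExp_le (by positivity) ((hQn w).trans ?_), (hGw w).trans ?_⟩
    · rw [inv_mul_le_iff₀ hσ, mul_one]
      exact hwm
    · have := (h.norm_sub_kklProj_le_of_mem_kklEllipsoid hwE n).trans htail
      gcongr
  · rw [← ofReal_norm, ← ofReal_norm, ← ofReal_norm, ← ENNReal.ofReal_mul (norm_nonneg _),
      Real.norm_of_nonneg (by positivity)]
    refine ENNReal.ofReal_le_ofReal ((hGw (μ s)).trans ?_)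
    have h1 : ‖m‖ + ‖μ s - m‖ ≤ 2 * ‖m‖ + ‖μ s‖ := by linarith [norm_sub_le (μ s) m]
    gcongr

end InputBound

/-! ### The two bounds combined -/

theorem theorem4 {d : ℕ} (Ω : Set (EuclideanSpace ℝ (Fin d)))
    (hΩ_open : IsOpen Ω) (hΩ_conn : IsConnected Ω) (hΩ_bdd : Bornology.IsBounded Ω)
    {V : Type*} [NormedAddCommGroup V] [InnerProductSpace ℝ V] [CompleteSpace V]
    [MeasurableSpace V] [BorelSpace V]
    {S : Type*} [MeasurableSpace S] (P : Measure S) [IsProbabilityMeasure P]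
    -- the Gaussian random field, jointly measurable, with mean and covariance kernel in `L²`
    (X : Ω → S → ℝ) (hX_gauss : IsGaussianProcess X P)
    (hX_meas : Measurable (fun p : Ω × S => X p.1 p.2))
    (hmean : MemLp (fun x : Ω => ∫ s, X x s ∂P) 2 (lebesgueOn Ω))
    (hcov : MemLp (fun p : Ω × Ω => cov[X p.1, X p.2; P]) 2 ((lebesgueOn Ω).prod (lebesgueOn Ω)))
    -- its trajectories lie in `L²(Ω)`: `μ s` is the class of the trajectory `X · s`
    (μ : S → L2 Ω) (hμ : ∀ᵐ s ∂P, (fun x : Ω => X x s) =ᵐ[lebesgueOn Ω] μ s)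
    -- the operator, with exponentially bounded local variation
    (G : L2 Ω → V) (A β : ℝ) (hA : 0 < A) (hβ : 0 < β)
    (hG : ∀ ν : L2 Ω, localVariation G ν ≤ ENNReal.ofReal (A * Real.exp (β * ‖ν‖))) :
    -- the centred input field and the output field have KKL expansions
    (∃ (lam_μ : ℕ → ℝ) (η : ℕ → S → ℝ) (φ : ℕ → L2 Ω),
      IsKKLExpansion P (fun s => μ s - hmean.toLp) lam_μ η φ) ∧
    (∃ (lam_u : ℕ → ℝ) (ω : ℕ → S → ℝ) (v : ℕ → V),
      IsKKLExpansion P (fun s => G (μ s)) lam_u ω v) ∧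
    -- the error bound, for all such expansions
    ∃ C : ℝ, 0 < C ∧ ∃ L₀ : ℕ → ℝ, (∀ n, 0 < L₀ n) ∧
      ∀ (lam_μ : ℕ → ℝ) (η : ℕ → S → ℝ) (φ : ℕ → L2 Ω),
        IsKKLExpansion P (fun s => μ s - hmean.toLp) lam_μ η φ →
      ∀ (lam_u : ℕ → ℝ) (ω : ℕ → S → ℝ) (v : ℕ → V),
        IsKKLExpansion P (fun s => G (μ s)) lam_u ω v →
      ∀ n : ℕ, 1 ≤ n → ∀ M : ℝ, 1 ≤ M → ∀ L : ℝ, L₀ n ≤ L →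
        optimalError P (fun s => G (μ s)) (G '' kklEllipsoid hmean.toLp lam_μ φ) M L n ≤
          ENNReal.ofReal (C * min √(∑' i, lam_μ (i + n)) √(∑' i, lam_u (i + n))) := by
  have hfin := isFiniteMeasure_lebesgueOn hΩ_open hΩ_bdd
  have hne := neZero_lebesgueOn hΩ_open hΩ_conn.nonempty
  have hsep := separableSpace_L2 hΩ_open hΩ_bdd
  have hμm : AEStronglyMeasurable μ P := aestronglyMeasurable_field hX_gauss hX_meas hmean hμ
  have hexp := integrable_exp_mul_norm_field hX_gauss hX_meas hmean hμ
  set m : L2 Ω := hmean.toLp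
  have hμ2 : MemLp (fun s => μ s - m) 2 P := (memLp_two_of_exp hμm hexp).sub (memLp_const m)
  have hu2 : MemLp (fun s => G (μ s)) 2 P :=
    memLp_two_comp_of_localVariation_le_exp hμm hexp hA hβ hG
  refine ⟨exists_isKKLExpansion hμ2, exists_isKKLExpansion hu2, ?_⟩
  -- `σ` dominates `√λ₀` for every expansion of the centred field, so the constants precede the
  -- choice of expansion; the `1` makes it positive.
  set σ : ℝ := √(∫ s, ‖μ s - m‖ ^ 2 ∂P) + 1
  have hσ : 0 < σ := by positivity
  -- The first summand is the error near the control set, the second the mean error of the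
  -- competitor; `max K 1` below also covers the output bound.
  set K : ℝ := A * Real.exp (β * (‖m‖ + σ)) +
    √(∫ s, (A * Real.exp (β * (2 * ‖m‖ + ‖μ s‖))) ^ 2 ∂P)
  set R : ℝ := ‖G m‖ + A * Real.exp (β * (‖m‖ + σ)) * σ
  have hR : 0 < R := by positivity
  -- The threshold for `L` is the larger of the two decoders' Lipschitz constants and does not vary
  -- with `n`.
  refine ⟨max K 1, by positivity,
    fun _ => max R (A * Real.exp (β * ‖m‖) * σ * Real.exp (2 * (β * σ))),
    fun _ => lt_max_of_lt_left hR, ?_⟩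
  intro lam_μ η φ hKμ lam_u ω v hKu n _ M hM L hL
  have hlam : √(lam_μ 0) ≤ σ :=
    (Real.sqrt_le_sqrt (hKμ.lam_zero_le hμ2)).trans (le_add_of_nonneg_right zero_le_one)
  have hB : ∀ b ∈ G '' kklEllipsoid m lam_μ φ, ‖b‖ ≤ R := by
    rintro _ ⟨w, hw, rfl⟩
    have hwm : ‖w - m‖ ≤ σ := (hKμ.norm_sub_le_of_mem_kklEllipsoid hw).trans hlam
    have hwn : ‖w‖ ≤ ‖m‖ + σ := by
      have := norm_add_le m (w - m)
      rw [add_sub_cancel] at this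
      linarith
    have h1 := norm_sub_le_of_localVariation_le_exp hA hβ hG hwn (le_add_of_nonneg_right hσ.le)
    have h2 := norm_add_le (G m) (G w - G m)
    rw [add_sub_cancel] at h2
    refine h2.trans (add_le_add_right (h1.trans ?_) _)
    gcongr
  rcases min_cases √(∑' i, lam_μ (i + n)) √(∑' i, lam_u (i + n)) with ⟨hmin, -⟩ | ⟨hmin, -⟩
  · rw [hmin]
    refine (hKμ.optimalError_comp_le hμm hexp hA hβ hG hσ hlam hM
      ((le_max_right _ _).trans hL) n).trans (ENNReal.ofReal_le_ofReal ?_)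
    exact mul_le_mul_of_nonneg_right (le_max_left _ _) (Real.sqrt_nonneg _)
  · rw [hmin]
    refine (hKu.optimalError_le hu2 hR hB hM ((le_max_left _ _).trans hL) n).trans
      (ENNReal.ofReal_le_ofReal ?_)
    exact le_mul_of_one_le_left (Real.sqrt_nonneg _) (le_max_right _ _)
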